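/- **Setting.** Let $\rho:[0,1]\to[0,1]$ be concave and non-increasing with $\rho(0)(1-\eta)\le\rho(\eta)\le 1-\eta$, put $\rho_0=\rho(0)$, let $\alpha_0>0$, and let $H_{\rho,\alpha_0,1}$ be the distribution on $(0,\infty)^2$ with cdf $$H_{\rho,\alpha_0,1}(x,y)=\begin{cases}\exp(-x^{-\alpha_0}), & y\ge x>0,\\ \exp(-y^{-\alpha_0})\{1+\rho((y/x)^{\alpha_0})\,y^{-\alpha_0}\}, & x>y>0.\end{cases}$$ Let $\gamma$ be the Euler–Mascheroni constant, $\Upsilon(x)=\rho_0\Gamma(x+2)+(1-\rho_0)\Gamma(x+1)$, let $\varpi$ be the unique zero in $(0,\infty)$ of $y\mapsto \frac1y-\frac{\Upsilon'(y)}{\Upsilon(y)}+\frac{\rho_0}{2}-\gamma$, and put $\alpha_1=\varpi\alpha_0$, $s_1=(2/\Upsilon(\varpi))^{1/\alpha_1}$. For each $n$ let $\boldsymbol Z_n=(Z_{n,i})_{i\le k_n}$, $Z_{n,i}=(X_{n,i},Y_{n,i})$, be a random array (on a probability space that may depend on $n$) with $0<Y_{n,i}\le X_{n,i}$, where $k_n\ge2$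 and $k_n\to\infty$. Unless all pairs $Z_{n,1},\dots,Z_{n,k_n}$ coincide, let $(\hat\alpha_n,\hat\sigma_n)$ be the maximizer over $(\alpha,\sigma)\in(0,\infty)^2$ of $$\ell(\alpha,\sigma)=2k_n\log\alpha+2k_n\alpha\log\sigma-\sum_{i=1}^{k_n}\{(\alpha+1)\log(X_{n,i}Y_{n,i})+\sigma^\alpha Y_{n,i}^{-\alpha}\};$$ if they all coincide, let $\hat\alpha_n=\infty$ and $\hat\sigma_n=Y_{n,1}$. Let $\sigma_n>0$, $0<v_n\to\infty$, and $$\mathbb P_nf=\frac1{k_n}\sum_{i=1}^{k_n}f\Big(\frac{X_{n,i}}{\sigma_n},\frac{Y_{n,i}}{\sigma_n}\Big),\qquad \mathbb G_nf=v_n\Big\{\mathbb P_nf-\int_{(0,\infty)^2}f\,dH_{\rho,\alpha_0,1}\Big\}.$$ **Assumptions.** (i) $\Pr(Z_{n,1}=\dots=Z_{n,k_n})\to0$. (ii) There are $0<\alpha_-<\alpha_1<\alpha_+<\infty$ such that $\mathbb P_nf\rightsquigarrow\int_{(0,\infty)^2} f\,dH_{\rho,\alpha_0,1}$ for $f(x,y)=\log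 x$, for $f(x,y)=\log y$, and for $f(x,y)=y^{-\alpha}(\log y)^m$ with $m\in\{0,1,2\}$ and all $\alpha\in(\alpha_-,\alpha_+)$. (iii) $(\mathbb G_nf_1,\mathbb G_nf_2,\mathbb G_nf_3,\mathbb G_nf_4)^\top\rightsquigarrow \boldsymbol W$ for some random vector $\boldsymbol W$ in $\mathbb R^4$, where $f_1=y^{-\alpha_1}\log y$, $f_2=y^{-\alpha_1}$, $f_3=\log y$, $f_4=\log x$. **Theorem (Asymptotic distribution).** As $n\to\infty$, $$v_n\begin{pmatrix}\hat\alpha_n-\alpha_1\\ \hat\sigma_n/\sigma_n-s_1\end{pmatrix}=M_{\rho_0}(\alpha_0)\begin{pmatrix}\mathbb G_nf_1\\ \mathbb G_nf_2\\ \mathbb G_nf_3\\ \mathbb G_nf_4\end{pmatrix}+o_{\mathbb P}(1)\rightsquigarrow M_{\rho_0}(\alpha_0)\boldsymbol W ,$$ where weak convergence is in $(-\infty,\infty]\times\mathbb R$ because of the value $\hat\alpha_n=\infty$, and where $M_{\rho_0}(\alpha_0)=(\beta_{jk})\in\mathbb R^{2\times4}$ is given as follows. Write $U=\Upsilon(\varpi)$,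 $U'=\Upsilon'(\varpi)$, $U''=\Upsilon''(\varpi)$, $z_0=U/2$ and $D=-\frac{2}{\alpha_1^2}-\frac{2(U''U-U'^2)}{\alpha_0^2U^2}$. Then $$(\beta_{11},\beta_{12},\beta_{13},\beta_{14})=\frac1D\Big(-\frac2U,\,-\frac{2U'}{\alpha_0U^2},\,1,\,1\Big),$$ $$\beta_{21}=\frac{z_0^{-1/\alpha_1}}{\alpha_1D}\Big\{\frac{U'}{2\alpha_0z_0^2}-\frac{\log z_0}{\alpha_1z_0}\Big\},\qquad \beta_{23}=\beta_{24}=\frac{z_0^{-1/\alpha_1}}{\alpha_1D}\Big\{\frac{\log z_0}{\alpha_1}-\frac{U'}{2\alpha_0z_0}\Big\},$$ $$\beta_{22}=\frac{z_0^{-1/\alpha_1}}{\alpha_1D}\Big\{\frac{U'^2}{4\alpha_0^2z_0^3}-\frac{U'\log z_0}{2\alpha_0\alpha_1z_0^2}\Big\}-\frac{z_0^{-1/\alpha_1-1}}{2\alpha_1}.$$ If $\rho_0=1$, then $\alpha_1=\alpha_0$ and $$M_1(\alpha_0)=\frac{6}{2\pi^2-3}\begin{pmatrix}\alpha_0^2&\frac{3-2\gamma}{2}\alpha_0&-\alpha_0^2&-\alpha_0^2\\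 \frac{2\gamma-3}{2}&\frac{3-2\pi^2-3(3-2\gamma)^2}{12\alpha_0}&\frac{3-2\gamma}{2}&\frac{3-2\gamma}{2}\end{pmatrix}.$$ -/

import Mathlib

open MeasureTheory Set Filter Topology
open scoped Matrix

/-- The functions `ρ : [0,1] → [0,1]` (extended arbitrarily to `ℝ`) that are concave, non-increasing
and satisfy `ρ(0)(1 - η) ≤ ρ(η) ≤ 1 - η`. -/
structure IsWelschFunction (ρ : ℝ → ℝ) : Prop where
  concaveOn : ConcaveOn ℝ (Icc 0 1) ρ
  antitoneOn : AntitoneOn ρ (Icc 0 1)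
  mapsTo : MapsTo ρ (Icc 0 1) (Icc 0 1)
  lower : ∀ η ∈ Icc (0 : ℝ) 1, ρ 0 * (1 - η) ≤ ρ η
  upper : ∀ η ∈ Icc (0 : ℝ) 1, ρ η ≤ 1 - η

namespace IsWelschFunction

variable {ρ : ℝ → ℝ}

theorem continuousOn (h : IsWelschFunction ρ) : ContinuousOn ρ (Icc 0 1) := by
  intro x hx
  have h0 : (0 : ℝ) ∈ Icc (0 : ℝ) 1 := by simp
  have hρ1 : ρ 1 = 0 := by
    have h1 : (1 : ℝ) ∈ Icc (0 : ℝ) 1 := by simp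
    have a := h.upper 1 h1
    have b := (h.mapsTo h1).1
    linarith
  rcases eq_or_lt_of_le hx.1 with hx0 | hx0
  · subst hx0
    have l : Tendsto (fun η : ℝ => ρ 0 * (1 - η)) (𝓝[Icc 0 1] 0) (𝓝 (ρ 0)) := by
      have : Continuous (fun η : ℝ => ρ 0 * (1 - η)) := by fun_prop
      have := (this.tendsto 0).mono_left (nhdsWithin_le_nhds (s := Icc (0 : ℝ) 1))
      simpa using this
    refine tendsto_of_tendsto_of_tendsto_of_le_of_le' l tendsto_const_nhds ?_ ?_
    · filter_upwards [self_mem_nhdsWithin] with η hη using h.lower η hη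
    · filter_upwards [self_mem_nhdsWithin] with η hη using h.antitoneOn h0 hη hη.1
  rcases eq_or_lt_of_le hx.2 with hx1 | hx1
  · subst hx1
    have l : Tendsto (fun η : ℝ => 1 - η) (𝓝[Icc 0 1] 1) (𝓝 0) := by
      have : Continuous (fun η : ℝ => 1 - η) := by fun_prop
      have := (this.tendsto 1).mono_left (nhdsWithin_le_nhds (s := Icc (0 : ℝ) 1))
      simpa using this
    rw [ContinuousWithinAt, hρ1]
    refine tendsto_of_tendsto_of_tendsto_of_le_of_le' tendsto_const_nhds l ?_ ?_
    · filter_upwards [self_mem_nhdsWithin] with η hη using (h.mapsTo hη).1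
    · filter_upwards [self_mem_nhdsWithin] with η hη using h.upper η hη
  · have hc := h.concaveOn.continuousOn_interior
    rw [interior_Icc] at hc
    exact (hc.continuousAt (Ioo_mem_nhds hx0 hx1)).continuousWithinAt

/-- `ρ(u) = E[min(1 - u, 1 - V)]` for a suitable random variable `V` in `[0,1]`; this is used to show
that the Fréchet-Welsch distribution exists. -/
theorem exists_mixing (h : IsWelschFunction ρ) :
    ∃ π : Measure ℝ, IsProbabilityMeasure π ∧ (∀ᵐ v ∂π, v ∈ Icc (0 : ℝ) 1) ∧
      ∀ u ∈ Icc (0 : ℝ) 1,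
        ∫⁻ v, ENNReal.ofReal (min (1 - u) (1 - v)) ∂π = ENNReal.ofReal (ρ u) := by
  have hρ1 : ρ 1 = 0 := by
    have h1 : (1 : ℝ) ∈ Icc (0 : ℝ) 1 := by simp
    have a := h.upper 1 h1
    have b := (h.mapsTo h1).1
    linarith
  have hconv : ConvexOn ℝ (Icc (0 : ℝ) 1) (-ρ) := h.concaveOn.neg
  set d : ℝ → ℝ := fun w => derivWithin (-ρ) (Ioi w) w with hd
  set g : ℝ → ℝ := fun w => if w ≤ 0 then 0 else if w < 1 then d w else 1 with hg
  have hder : ∀ x ∈ Ioo (0 : ℝ) 1, HasDerivWithinAt (-ρ) (d x) (Ioi x) x := fun x hx =>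
    hconv.hasDerivWithinAt_rightDeriv_of_mem_interior (by rwa [interior_Icc])
  have hdm : MonotoneOn d (Ioo 0 1) := by
    have := hconv.monotoneOn_rightDeriv
    rwa [interior_Icc] at this
  have hd0 : ∀ x ∈ Ioo (0 : ℝ) 1, 0 ≤ d x := by
    intro x hx
    have e := hconv.rightDeriv_eq_sInf_slope_of_mem_interior (x := x) (by rwa [interior_Icc])
    simp only [hd]
    rw [e]
    apply Real.sInf_nonneg
    rintro _ ⟨y, ⟨hy, hxy⟩, rfl⟩
    rw [slope_def_field]
    have := h.antitoneOn ⟨hx.1.le, hx.2.le⟩ hy hxy.le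
    apply div_nonneg _ (by linarith)
    simp only [Pi.neg_apply]
    linarith
  have hd1 : ∀ x ∈ Ioo (0 : ℝ) 1, d x ≤ 1 := by
    intro x hx
    have := hconv.rightDeriv_le_slope_of_mem_interior (x := x) (y := 1)
      (by rwa [interior_Icc]) (by simp) hx.2
    refine this.trans ?_
    rw [slope_def_field, div_le_one (by linarith [hx.2])]
    have := h.upper x ⟨hx.1.le, hx.2.le⟩
    simp [hρ1]; linarith
  have hgm : Monotone g := by
    intro a b hab
    simp only [hg]
    split_ifs with h1 h2 h3 h4 h5 h6 h7 <;> first | linarith | skip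
    · exact hd0 b ⟨by linarith, h3⟩
    · exact hdm ⟨by linarith, by linarith⟩ ⟨by linarith, by linarith⟩ hab
    · exact hd1 a ⟨by linarith, by linarith⟩
  have hGlow : ∀ w < 0, hgm.stieltjesFunction w = 0 := by
    intro w hw
    rw [Monotone.stieltjesFunction_eq, ContinuousWithinAt.rightLim_eq]
    · simp [hg, hw.le]
    · refine ContinuousAt.continuousWithinAt (ContinuousAt.congr (f := fun _ => (0 : ℝ)) continuousAt_const ?_)
      filter_upwards [Iio_mem_nhds hw] with y hy
      simp [hg, (mem_Iio.1 hy).le]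
  have hGup : ∀ w ≥ 1, hgm.stieltjesFunction w = 1 := by
    intro w hw
    have hw0 : ¬ w ≤ 0 := by linarith
    rw [Monotone.stieltjesFunction_eq, ContinuousWithinAt.rightLim_eq]
    · simp [hg, hw0, hw]
    · refine ContinuousWithinAt.congr (f := fun _ => (1 : ℝ)) continuousWithinAt_const ?_ ?_
      · intro y hy
        have h1 : 1 ≤ y := hw.le.trans hy
        have h2 : ¬ y ≤ 0 := by linarith
        simp [hg, h1, h2]
      · simp [hg, hw0, hw]
  have hbot : Tendsto hgm.stieltjesFunction atBot (𝓝 0) := by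
    refine tendsto_const_nhds.congr' ?_
    filter_upwards [eventually_lt_atBot 0] with w hw using (hGlow w hw).symm
  have htop : Tendsto hgm.stieltjesFunction atTop (𝓝 1) := by
    refine tendsto_const_nhds.congr' ?_
    filter_upwards [eventually_ge_atTop 1] with w hw using (hGup w hw).symm
  set π := hgm.stieltjesFunction.measure with hπ
  have hP : IsProbabilityMeasure π := StieltjesFunction.isProbabilityMeasure _ hbot htop
  have hIic : ∀ w, π (Iic w) = ENNReal.ofReal (hgm.stieltjesFunction w) := by
    intro w
    rw [hπ, StieltjesFunction.measure_Iic _ hbot, sub_zero]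
  refine ⟨π, hP, ?_, ?_⟩
  · have h1 : ∀ᵐ v ∂π, v ≤ 1 := by
      have : π (Iic 1)ᶜ = 0 := by
        rw [prob_compl_eq_zero_iff measurableSet_Iic, hIic, hGup 1 le_rfl]
        simp
      rw [ae_iff]
      convert this using 2
      ext v
      simp
    have h2 : ∀ᵐ v ∂π, 0 ≤ v := by
      have : ∀ n : ℕ, ∀ᵐ v ∂π, -1 / ((n : ℝ) + 1) < v := by
        intro n
        have h3 : π (Iic (-1 / ((n : ℝ) + 1))) = 0 := by
          rw [hIic, hGlow]
          · simp
          · exact div_neg_of_neg_of_pos (by norm_num) (by positivity)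
        rw [ae_iff]
        convert h3 using 2
        ext v
        simp
      filter_upwards [ae_all_iff.2 this] with v hv
      have l : Tendsto (fun n : ℕ => -(1 / ((n : ℝ) + 1))) atTop (𝓝 (-0)) :=
        tendsto_one_div_add_atTop_nhds_zero_nat.neg
      rw [neg_zero] at l
      refine le_of_tendsto l (Eventually.of_forall fun n => ?_)
      have := (hv n).le
      rwa [neg_div] at this
    filter_upwards [h1, h2] with v a b using ⟨b, a⟩
  · intro u hu
    have hS : MeasurableSet {p : ℝ × ℝ | p.1 ≤ p.2 ∧ u < p.2 ∧ p.2 ≤ 1} := by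
      measurability
    have e1 := Measure.prod_apply (μ := π) (ν := (volume : Measure ℝ)) hS
    have e2 := Measure.prod_apply_symm (μ := π) (ν := (volume : Measure ℝ)) hS
    have a1 : ∀ v, volume (Prod.mk v ⁻¹' {p : ℝ × ℝ | p.1 ≤ p.2 ∧ u < p.2 ∧ p.2 ≤ 1})
        = ENNReal.ofReal (min (1 - u) (1 - v)) := by
      intro v
      rcases le_or_gt v u with hvu | hvu
      · have : (Prod.mk v ⁻¹' {p : ℝ × ℝ | p.1 ≤ p.2 ∧ u < p.2 ∧ p.2 ≤ 1}) = Ioc u 1 := by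
          ext w
          simp only [mem_preimage, mem_ofPred_eq, mem_Ioc]
          exact ⟨fun q => q.2, fun q => ⟨hvu.trans q.1.le, q⟩⟩
        rw [this, Real.volume_Ioc, min_eq_left (by linarith)]
      · have : (Prod.mk v ⁻¹' {p : ℝ × ℝ | p.1 ≤ p.2 ∧ u < p.2 ∧ p.2 ≤ 1}) = Icc v 1 := by
          ext w
          simp only [mem_preimage, mem_ofPred_eq, mem_Icc]
          exact ⟨fun q => ⟨q.1, q.2.2⟩, fun q => ⟨q.1, hvu.trans_le q.1, q.2⟩⟩
        rw [this, Real.volume_Icc, min_eq_right (by linarith)]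
    have a2 : ∀ w, π ((fun v => (v, w)) ⁻¹' {p : ℝ × ℝ | p.1 ≤ p.2 ∧ u < p.2 ∧ p.2 ≤ 1})
        = (Ioc u 1).indicator (fun w => ENNReal.ofReal (hgm.stieltjesFunction w)) w := by
      intro w
      by_cases hw : w ∈ Ioc u 1
      · rw [indicator_of_mem hw, ← hIic]
        congr 1
        ext v
        simp only [mem_preimage, mem_ofPred_eq, mem_Iic]
        exact ⟨fun q => q.1, fun q => ⟨q, hw.1, hw.2⟩⟩
      · rw [indicator_of_notMem hw]
        have : ((fun v => (v, w)) ⁻¹' {p : ℝ × ℝ | p.1 ≤ p.2 ∧ u < p.2 ∧ p.2 ≤ 1}) = ∅ := by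
          ext v
          simp only [mem_preimage, mem_ofPred_eq, mem_empty_iff_false, iff_false]
          exact fun q => hw ⟨q.2.1, q.2.2⟩
        rw [this, measure_empty]
    simp only [a1] at e1
    simp only [a2] at e2
    rw [← e1, e2, lintegral_indicator measurableSet_Ioc]
    have hae : ∀ᵐ w ∂(volume.restrict (Ioc u 1)), ENNReal.ofReal (hgm.stieltjesFunction w)
        = ENNReal.ofReal (g w) := by
      apply ae_restrict_of_ae
      have := hgm.countable_not_continuousAt.ae_notMem (volume : Measure ℝ)
      filter_upwards [this] with w hw
      have hw' : ContinuousAt g w := by simpa using hw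
      rw [Monotone.stieltjesFunction_eq, hw'.continuousWithinAt.rightLim_eq]
    rw [lintegral_congr_ae hae]
    have hgi : IntervalIntegrable g volume u 1 := hgm.intervalIntegrable
    have hg0 : ∀ w, 0 ≤ g w := by
      intro w
      have := hgm (min_le_left w 0)
      simpa [hg] using this
    rw [← ofReal_integral_eq_lintegral_ofReal hgi.1 (Eventually.of_forall hg0),
      ← intervalIntegral.integral_of_le hu.2]
    congr 1
    have := intervalIntegral.integral_eq_sub_of_hasDeriv_right_of_le (f := -ρ) (f' := g) hu.2
      ((h.continuousOn.mono (Icc_subset_Icc_left hu.1)).neg) ?_ hgi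
    · rw [this]; simp [hρ1]
    · intro x hx
      have h0 : ¬ x ≤ 0 := by linarith [hx.1, hu.1]
      have : g x = d x := by simp [hg, h0, hx.2]
      rw [this]
      exact hder x ⟨by linarith [hx.1, hu.1], hx.2⟩


end IsWelschFunction

noncomputable section

/-- The bivariate cdf `H_{ρ,α,σ}`, extended by zero outside `(0,∞)²`. -/
def frechetWelschCDF (ρ : ℝ → ℝ) (α σ x y : ℝ) : ℝ :=
  if x ≤ 0 ∨ y ≤ 0 then 0
  else if x ≤ y then Real.exp (-(x / σ) ^ (-α))
  else Real.exp (-(y / σ) ^ (-α)) * (1 + ρ ((y / x) ^ α) * (y / σ) ^ (-α))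

/-- `μ` is a probability measure with cdf `H_{ρ,α,σ}`. -/
def IsFrechetWelsch (ρ : ℝ → ℝ) (α σ : ℝ) (μ : Measure (ℝ × ℝ)) : Prop :=
  IsProbabilityMeasure μ ∧
    ∀ x y : ℝ, μ (Iic x ×ˢ Iic y) = ENNReal.ofReal (frechetWelschCDF ρ α σ x y)

/-- The standard exponential distribution (only used in the existence proof below). -/
def unitExp : Measure ℝ :=
  (volume.restrict (Ioi 0)).withDensity (fun x => ENNReal.ofReal (Real.exp (-x)))

theorem unitExp_Ici {a : ℝ} (ha : 0 ≤ a) :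
    unitExp (Ici a) = ENNReal.ofReal (Real.exp (-a)) := by
  have hi : IntegrableOn (fun x => Real.exp (-x)) (Ioi a) := by
    simpa using exp_neg_integrableOn_Ioi a one_pos
  rw [unitExp, withDensity_apply _ measurableSet_Ici, Measure.restrict_restrict measurableSet_Ici]
  have : (Ici a ∩ Ioi 0 : Set ℝ) =ᵐ[volume] Ioi a := by
    have h1 : (Ici a : Set ℝ) =ᵐ[volume] Ioi a := Ioi_ae_eq_Ici.symm
    have h2 := h1.inter (ae_eq_refl (Ioi (0 : ℝ)))
    rwa [inter_eq_left.2 (Ioi_subset_Ioi ha)] at h2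
  rw [Measure.restrict_congr_set this, ← integral_exp_neg_Ioi,
    ofReal_integral_eq_lintegral_ofReal hi (Eventually.of_forall fun x => (Real.exp_pos _).le)]

theorem unitExp_pos : ∀ᵐ x ∂unitExp, 0 < x := by
  have : ∀ᵐ x ∂(volume.restrict (Ioi (0 : ℝ))), 0 < x := ae_restrict_mem measurableSet_Ioi
  exact (withDensity_absolutelyContinuous _ _).ae_le this

instance unitExp_isProbabilityMeasure : IsProbabilityMeasure unitExp := by
  constructor
  have h1 : unitExp univ = unitExp (Ici 0) := by
    apply measure_congr
    filter_upwards [unitExp_pos] with x hx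
    exact propext ⟨fun _ => hx.le, fun _ => trivial⟩
  rw [h1, unitExp_Ici le_rfl]
  simp

theorem unitExp_prod {m t : ℝ} (hm : 0 ≤ m) :
    (unitExp.prod unitExp) {p : ℝ × ℝ | m ≤ p.1 ∧ t ≤ p.1 + p.2} =
      ENNReal.ofReal (if m ≤ t then Real.exp (-t) * (1 + (t - m)) else Real.exp (-m)) := by
  have hS : MeasurableSet {p : ℝ × ℝ | m ≤ p.1 ∧ t ≤ p.1 + p.2} := by measurability
  rw [Measure.prod_apply hS]
  have a1 : ∀ x, unitExp (Prod.mk x ⁻¹' {p : ℝ × ℝ | m ≤ p.1 ∧ t ≤ p.1 + p.2}) =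
      (Ici m).indicator (fun x => ENNReal.ofReal (Real.exp (-(max (t - x) 0)))) x := by
    intro x
    by_cases hx : x ∈ Ici m
    · rw [indicator_of_mem hx]
      have : (Prod.mk x ⁻¹' {p : ℝ × ℝ | m ≤ p.1 ∧ t ≤ p.1 + p.2}) = Ici (t - x) := by
        ext y
        simp only [mem_preimage, mem_ofPred_eq, mem_Ici, tsub_le_iff_left]
        exact ⟨fun q => q.2, fun q => ⟨hx, q⟩⟩
      rw [this, ← unitExp_Ici (le_max_right _ _)]
      apply measure_congr
      filter_upwards [unitExp_pos] with y hy
      exact propext ⟨fun (q : t - x ≤ y) => max_le q hy.le,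
        fun (q : max (t - x) 0 ≤ y) => (le_max_left (t - x) 0).trans q⟩
    · rw [indicator_of_notMem hx]
      have : (Prod.mk x ⁻¹' {p : ℝ × ℝ | m ≤ p.1 ∧ t ≤ p.1 + p.2}) = ∅ := by
        ext y
        simp only [mem_preimage, mem_ofPred_eq, mem_empty_iff_false, iff_false]
        exact fun q => hx q.1
      rw [this, measure_empty]
  simp only [a1]
  rw [lintegral_indicator measurableSet_Ici, unitExp, restrict_withDensity measurableSet_Ici,
    Measure.restrict_restrict measurableSet_Ici]
  have hset : (Ici m ∩ Ioi 0 : Set ℝ) =ᵐ[volume] Ioi m := by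
    have h1 : (Ici m : Set ℝ) =ᵐ[volume] Ioi m := Ioi_ae_eq_Ici.symm
    have h2 := h1.inter (ae_eq_refl (Ioi (0 : ℝ)))
    rwa [inter_eq_left.2 (Ioi_subset_Ioi hm)] at h2
  rw [Measure.restrict_congr_set hset,
    lintegral_withDensity_eq_lintegral_mul _ (by fun_prop) (by fun_prop)]
  have a2 : ∀ x, ((fun x => ENNReal.ofReal (Real.exp (-x))) *
      fun x => ENNReal.ofReal (Real.exp (-(max (t - x) 0)))) x =
      ENNReal.ofReal (Real.exp (-(max t x))) := by
    intro x
    rw [Pi.mul_apply, ← ENNReal.ofReal_mul (Real.exp_pos _).le, ← Real.exp_add]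
    congr 2
    rcases le_total t x with h | h
    · rw [max_eq_right (by linarith), max_eq_right h]; ring
    · rw [max_eq_left (by linarith), max_eq_left h]; ring
  rw [lintegral_congr a2]
  have tail : ∀ c, t ≤ c → ∫⁻ x in Ioi c, ENNReal.ofReal (Real.exp (-(max t x))) =
      ENNReal.ofReal (Real.exp (-c)) := by
    intro c hc
    have hi : IntegrableOn (fun x => Real.exp (-x)) (Ioi c) := by
      simpa using exp_neg_integrableOn_Ioi c one_pos
    rw [← integral_exp_neg_Ioi,
      ofReal_integral_eq_lintegral_ofReal hi (Eventually.of_forall fun x => (Real.exp_pos _).le)]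
    apply setLIntegral_congr_fun measurableSet_Ioi
    intro x hx
    simp only [max_eq_right (hc.trans (mem_Ioi.1 hx).le)]
  split_ifs with h
  · rw [← Ioc_union_Ioi_eq_Ioi h, lintegral_union measurableSet_Ioi Ioc_disjoint_Ioi_same,
      tail t le_rfl]
    have : ∫⁻ x in Ioc m t, ENNReal.ofReal (Real.exp (-(max t x))) =
        ∫⁻ x in Ioc m t, ENNReal.ofReal (Real.exp (-t)) := by
      apply setLIntegral_congr_fun measurableSet_Ioc
      intro x hx
      simp only [max_eq_left hx.2]
    rw [this, setLIntegral_const, Real.volume_Ioc, ← ENNReal.ofReal_mul (Real.exp_pos _).le,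
      ← ENNReal.ofReal_add (mul_nonneg (Real.exp_pos _).le (by linarith)) (Real.exp_pos _).le]
    congr 1
    ring
  · exact tail m (by linarith)

theorem scale_rpow_le_iff {α σ s x : ℝ} (hα : 0 < α) (hσ : 0 < σ) (hs : 0 < s) (hx : 0 < x) :
    σ * s ^ (-(1 / α)) ≤ x ↔ (x / σ) ^ (-α) ≤ s := by
  have e : (s ^ (-(1 / α))) ^ (-α) = s := by
    rw [← Real.rpow_mul hs.le]
    have : -(1 / α) * -α = 1 := by field_simp
    rw [this, Real.rpow_one]
  rw [← le_div_iff₀' hσ]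
  nth_rewrite 2 [← e]
  rw [Real.rpow_le_rpow_iff_of_neg (by positivity) (by positivity) (by linarith)]

/-- Existence: if `E₁, E₂` are standard exponential, independent of each other and of `V`, then
`(σ E₁^{-1/α}, σ min(E₁ + E₂, E₁ / V)^{-1/α})` has cdf `H_{ρ,α,σ}`. -/
theorem exists_isFrechetWelsch {ρ : ℝ → ℝ} (h : IsWelschFunction ρ) {α σ : ℝ} (hα : 0 < α)
    (hσ : 0 < σ) : ∃ μ, IsFrechetWelsch ρ α σ μ := by
  obtain ⟨π, hπ, hsupp, hint⟩ := h.exists_mixing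
  set T : ℝ × ℝ × ℝ → ℝ := fun p =>
    if p.1 ≤ 0 then p.2.1 + p.2.2 else min (p.2.1 + p.2.2) (p.2.1 / p.1) with hT
  set Φ : ℝ × ℝ × ℝ → ℝ × ℝ := fun p =>
    (σ * p.2.1 ^ (-(1 / α)), σ * T p ^ (-(1 / α))) with hΦ
  have hTm : Measurable T := by
    apply Measurable.ite
    · measurability
    · fun_prop
    · fun_prop
  have hΦm : Measurable Φ := by fun_prop
  have hae : ∀ᵐ p ∂(π.prod (unitExp.prod unitExp)),
      p.1 ∈ Icc (0 : ℝ) 1 ∧ 0 < p.2.1 ∧ 0 < p.2.2 := by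
    have q1 : ∀ᵐ p ∂(π.prod (unitExp.prod unitExp)), p.1 ∈ Icc (0 : ℝ) 1 :=
      Measure.quasiMeasurePreserving_fst.ae hsupp
    have q2 : ∀ᵐ p ∂(unitExp.prod unitExp), 0 < p.1 :=
      Measure.quasiMeasurePreserving_fst.ae unitExp_pos
    have q3 : ∀ᵐ p ∂(unitExp.prod unitExp), 0 < p.2 :=
      Measure.quasiMeasurePreserving_snd.ae unitExp_pos
    have q4 : ∀ᵐ p ∂(π.prod (unitExp.prod unitExp)), 0 < p.2.1 :=
      Measure.quasiMeasurePreserving_snd.ae q2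
    have q5 : ∀ᵐ p ∂(π.prod (unitExp.prod unitExp)), 0 < p.2.2 :=
      Measure.quasiMeasurePreserving_snd.ae q3
    filter_upwards [q1, q4, q5] with p a b c using ⟨a, b, c⟩
  have hTpos : ∀ p : ℝ × ℝ × ℝ, 0 < p.2.1 → 0 < p.2.2 → 0 < T p := by
    intro p a b
    simp only [hT]
    split_ifs with c
    · positivity
    · have : 0 < p.1 := by linarith
      positivity
  refine ⟨(π.prod (unitExp.prod unitExp)).map Φ,
    Measure.isProbabilityMeasure_map hΦm.aemeasurable, ?_⟩
  intro x y
  rw [Measure.map_apply hΦm (measurableSet_Iic.prod measurableSet_Iic), frechetWelschCDF]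
  split_ifs with h1 h2
  · rw [ENNReal.ofReal_zero, ← nonpos_iff_eq_zero, nonpos_iff_eq_zero, measure_eq_zero_iff_ae_notMem]
    filter_upwards [hae] with p hp hmem
    have t1 := hTpos p hp.2.1 hp.2.2
    have m1 : σ * p.2.1 ^ (-(1 / α)) ≤ x := hmem.1
    have m2 : σ * T p ^ (-(1 / α)) ≤ y := hmem.2
    have n1 : 0 < σ * p.2.1 ^ (-(1 / α)) := mul_pos hσ (Real.rpow_pos_of_pos hp.2.1 _)
    have n2 : 0 < σ * T p ^ (-(1 / α)) := mul_pos hσ (Real.rpow_pos_of_pos t1 _)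
    rcases h1 with h1 | h1 <;> linarith
  all_goals
    push Not at h1
    obtain ⟨hx, hy⟩ := h1
    set s := (x / σ) ^ (-α) with hs
    set t := (y / σ) ^ (-α) with ht
    have hs0 : 0 < s := by positivity
    have ht0 : 0 < t := by positivity
    have hev : (π.prod (unitExp.prod unitExp)) (Φ ⁻¹' (Iic x ×ˢ Iic y)) =
        (π.prod (unitExp.prod unitExp))
          {p | max s (p.1 * t) ≤ p.2.1 ∧ t ≤ p.2.1 + p.2.2} := by
      apply measure_congr
      filter_upwards [hae] with p hp
      have t1 := hTpos p hp.2.1 hp.2.2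
      have m1 := scale_rpow_le_iff hα hσ hp.2.1 hx
      have m2 := scale_rpow_le_iff hα hσ t1 hy
      have m3 : t ≤ T p ↔ t ≤ p.2.1 + p.2.2 ∧ p.1 * t ≤ p.2.1 := by
        simp only [hT]
        split_ifs with c
        · have : p.1 * t ≤ p.2.1 := (mul_nonpos_of_nonpos_of_nonneg c ht0.le).trans hp.2.1.le
          exact ⟨fun q => ⟨q, this⟩, fun q => q.1⟩
        · rw [le_min_iff, le_div_iff₀ (by linarith), mul_comm t]
      have m4 : p ∈ Φ ⁻¹' (Iic x ×ˢ Iic y) ↔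
          p ∈ {p : ℝ × ℝ × ℝ | max s (p.1 * t) ≤ p.2.1 ∧ t ≤ p.2.1 + p.2.2} := by
        change (σ * p.2.1 ^ (-(1 / α)) ≤ x ∧ σ * T p ^ (-(1 / α)) ≤ y) ↔
          (max s (p.1 * t) ≤ p.2.1 ∧ t ≤ p.2.1 + p.2.2)
        rw [m1, m2, m3, max_le_iff]
        tauto
      exact propext m4
    have hS : MeasurableSet {p : ℝ × ℝ × ℝ | max s (p.1 * t) ≤ p.2.1 ∧ t ≤ p.2.1 + p.2.2} := by
      measurability
    have hfib : ∀ v, (unitExp.prod unitExp) (Prod.mk v ⁻¹'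
        {p : ℝ × ℝ × ℝ | max s (p.1 * t) ≤ p.2.1 ∧ t ≤ p.2.1 + p.2.2}) =
        ENNReal.ofReal (if max s (v * t) ≤ t then Real.exp (-t) * (1 + (t - max s (v * t)))
          else Real.exp (-(max s (v * t)))) := fun v =>
      unitExp_prod (m := max s (v * t)) (hs0.le.trans (le_max_left _ _))
    rw [hev, Measure.prod_apply hS]
    simp only [hfib]
  · have hts : t ≤ s := by
      rw [hs, ht, Real.rpow_le_rpow_iff_of_neg (by positivity) (by positivity) (by linarith)]
      gcongr
    have : ∀ᵐ v ∂π, ENNReal.ofReal (if max s (v * t) ≤ t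
        then Real.exp (-t) * (1 + (t - max s (v * t))) else Real.exp (-(max s (v * t)))) =
        ENNReal.ofReal (Real.exp (-s)) := by
      filter_upwards [hsupp] with v hv
      have e : max s (v * t) = s := max_eq_left (by nlinarith [hv.2])
      rw [e]
      split_ifs with c
      · have : s = t := le_antisymm c hts
        rw [this]; simp
      · rfl
    rw [lintegral_congr_ae this, lintegral_const, measure_univ, mul_one]
  · have hst : s < t := by
      rw [hs, ht, Real.rpow_lt_rpow_iff_of_neg (by positivity) (by positivity) (by linarith)]
      gcongr
      linarith
    have hu : (y / x) ^ α = s / t := by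
      rw [hs, ht, ← Real.div_rpow (by positivity) (by positivity), Real.rpow_neg (by positivity),
        ← Real.inv_rpow (by positivity)]
      congr 1
      field_simp
    have hu' : s / t ∈ Icc (0 : ℝ) 1 := ⟨by positivity, (div_le_one ht0).2 hst.le⟩
    have : ∀ᵐ v ∂π, ENNReal.ofReal (if max s (v * t) ≤ t
        then Real.exp (-t) * (1 + (t - max s (v * t))) else Real.exp (-(max s (v * t)))) =
        ENNReal.ofReal (Real.exp (-t)) *
          (1 + ENNReal.ofReal t * ENNReal.ofReal (min (1 - s / t) (1 - v))) := by
      filter_upwards [hsupp] with v hv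
      have e0 : 0 ≤ min (1 - s / t) (1 - v) :=
        le_min (by linarith [hu'.2]) (by linarith [hv.2])
      have e : t - max s (v * t) = t * min (1 - s / t) (1 - v) := by
        have : t * min (1 - s / t) (1 - v) = min (t * (1 - s / t)) (t * (1 - v)) :=
          (mul_min_of_nonneg _ _ ht0.le)
        rw [this]
        have e1 : t * (1 - s / t) = t - s := by field_simp
        have e2 : t * (1 - v) = t - v * t := by ring
        rw [e1, e2, min_sub_sub_left]
      rw [if_pos (max_le hst.le (by nlinarith [hv.2])), e, ENNReal.ofReal_mul (Real.exp_pos _).le,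
        ENNReal.ofReal_add zero_le_one (by positivity), ENNReal.ofReal_mul ht0.le,
        ENNReal.ofReal_one]
    rw [lintegral_congr_ae this, lintegral_const_mul _ (by fun_prop),
      lintegral_add_left (by fun_prop), lintegral_const_mul _ (by fun_prop), hint _ hu',
      lintegral_const, measure_univ, mul_one, hu, ENNReal.ofReal_mul (Real.exp_pos _).le,
      ENNReal.ofReal_add zero_le_one (mul_nonneg (h.mapsTo hu').1 ht0.le), mul_comm (ρ _),
      ENNReal.ofReal_mul ht0.le, ENNReal.ofReal_one]

/-- The Fréchet-Welsch distribution `𝒲(ρ, α, σ)`: the probability measure with cdf `H_{ρ,α,σ}`. -/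
def frechetWelsch (ρ : ℝ → ℝ) (α σ : ℝ) : Measure (ℝ × ℝ) :=
  Classical.epsilon (IsFrechetWelsch ρ α σ)

theorem isFrechetWelsch_frechetWelsch {ρ : ℝ → ℝ} (h : IsWelschFunction ρ) {α σ : ℝ} (hα : 0 < α)
    (hσ : 0 < σ) : IsFrechetWelsch ρ α σ (frechetWelsch ρ α σ) :=
  Classical.epsilon_spec (exists_isFrechetWelsch h hα hσ)

/-! Maximum likelihood for the standard Fréchet-Welsch distribution; a sample is
`z = ((x₁, y₁), …, (x_k, y_k))`. -/

/-- The independence log-likelihood `ℓ(α, σ | z)`, with `θ = (α, σ)`. -/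
def logLik {k : ℕ} (z : Fin k → ℝ × ℝ) (θ : ℝ × ℝ) : ℝ :=
  2 * k * Real.log θ.1 + 2 * k * θ.1 * Real.log θ.2 -
    ∑ i, ((θ.1 + 1) * Real.log ((z i).1 * (z i).2) + θ.2 ^ θ.1 * (z i).2 ^ (-θ.1))

/-- `θ` maximizes the log-likelihood over `Θ = (0,∞)²`. -/
def IsMLE {k : ℕ} (z : Fin k → ℝ × ℝ) (θ : ℝ × ℝ) : Prop :=
  θ ∈ Ioi (0 : ℝ) ×ˢ Ioi (0 : ℝ) ∧ IsMaxOn (logLik z) (Ioi (0 : ℝ) ×ˢ Ioi (0 : ℝ)) θ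

/-- All pairs in the sample coincide. -/
def AllEqual {k : ℕ} (z : Fin k → ℝ × ℝ) : Prop := ∀ i j, z i = z j

open scoped Classical in
/-- The shape estimator `α̂(z)`, equal to `∞` if all pairs coincide. -/
def shapeMLE {k : ℕ} (z : Fin k → ℝ × ℝ) : EReal :=
  if AllEqual z then ⊤ else (((Classical.epsilon (IsMLE z)).1 : ℝ) : EReal)

open scoped Classical in
/-- The scale estimator `σ̂(z)`, equal to `y₁` if all pairs coincide. -/
def scaleMLE {k : ℕ} (z : Fin k → ℝ × ℝ) : ℝ :=
  if AllEqual z then (if h : 0 < k then (z ⟨0, h⟩).2 else 0) else (Classical.epsilon (IsMLE z)).2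

/-! The limiting parameters; `r` stands for `ρ₀ = ρ(0)`. -/

/-- `Υ_{ρ₀}(x) = ρ₀ Γ(x + 2) + (1 - ρ₀) Γ(x + 1)`. -/
def Upsilon (r x : ℝ) : ℝ := r * Real.Gamma (x + 2) + (1 - r) * Real.Gamma (x + 1)

/-- `Π_{ρ₀}(y) = 1/y - Υ'(y)/Υ(y) + ρ₀/2 - γ`. -/
def PiFun (r y : ℝ) : ℝ :=
  1 / y - deriv (Upsilon r) y / Upsilon r y + r / 2 - Real.eulerMascheroniConstant

/-- `ϖ_{ρ₀}`, the (unique) zero of `Π_{ρ₀}` in `(0,∞)`. -/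
def varpi (r : ℝ) : ℝ := Classical.epsilon fun y => 0 < y ∧ PiFun r y = 0

/-- `α₁ = ϖ_{ρ₀} α₀`. -/
def alphaOne (r α₀ : ℝ) : ℝ := varpi r * α₀

/-- `s₁ = (2 / Υ_{ρ₀}(ϖ_{ρ₀}))^{1/α₁}`. -/
def sOne (r α₀ : ℝ) : ℝ := (2 / Upsilon r (varpi r)) ^ (1 / alphaOne r α₀)

/-- The limiting slope `Ψ̇_{ρ,α₀}(α₁)`. -/
def psiDot (r α₀ : ℝ) : ℝ :=
  -2 / alphaOne r α₀ ^ 2 -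
    2 * (deriv (deriv (Upsilon r)) (varpi r) * Upsilon r (varpi r) -
      deriv (Upsilon r) (varpi r) ^ 2) / (α₀ ^ 2 * Upsilon r (varpi r) ^ 2)

/-- The matrix `M_{ρ₀}(α₀)`. -/
def limitMatrix (r α₀ : ℝ) : Matrix (Fin 2) (Fin 4) ℝ :=
  let α₁ := alphaOne r α₀
  let u := Upsilon r (varpi r)
  let u' := deriv (Upsilon r) (varpi r)
  let D := psiDot r α₀
  let z₀ := u / 2
  let c := z₀ ^ (-(1 / α₁)) / (α₁ * D)
  !![-(2 / u) / D, -(2 * u' / (α₀ * u ^ 2)) / D, 1 / D, 1 / D;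
    c * (u' / (2 * α₀ * z₀ ^ 2) - Real.log z₀ / (α₁ * z₀)),
    c * (u' ^ 2 / (4 * α₀ ^ 2 * z₀ ^ 3) - u' * Real.log z₀ / (2 * α₀ * α₁ * z₀ ^ 2)) -
      z₀ ^ (-(1 / α₁) - 1) / (2 * α₁),
    c * (Real.log z₀ / α₁ - u' / (2 * α₀ * z₀)),
    c * (Real.log z₀ / α₁ - u' / (2 * α₀ * z₀))]

/-! Function classes and empirical quantities. -/

/-- The class `ℱ₁(α₋, α₊)`. -/
def classF1 (αm αp : ℝ) : Set (ℝ × ℝ → ℝ) :=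
  {fun z => Real.log z.1} ∪ {fun z => Real.log z.2} ∪
    {f | ∃ α ∈ Ioo αm αp, f = fun z => z.2 ^ (-α)} ∪
    {f | ∃ α ∈ Ioo αm αp, f = fun z => z.2 ^ (-α) * Real.log z.2}

/-- The class `ℱ₂(α₋, α₊)`. -/
def classF2 (αm αp : ℝ) : Set (ℝ × ℝ → ℝ) :=
  classF1 αm αp ∪ {f | ∃ α ∈ Ioo αm αp, f = fun z => z.2 ^ (-α) * Real.log z.2 ^ 2}

/-- The functions `f₁, f₂, f₃, f₄`. -/
def testFun (α₁ : ℝ) : Fin 4 → ℝ × ℝ → ℝ :=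
  ![fun z => z.2 ^ (-α₁) * Real.log z.2, fun z => z.2 ^ (-α₁), fun z => Real.log z.2,
    fun z => Real.log z.1]

/-- `k⁻¹ ∑ᵢ f(xᵢ/σ, yᵢ/σ)`. -/
def empMean {k : ℕ} (z : Fin k → ℝ × ℝ) (σ : ℝ) (f : ℝ × ℝ → ℝ) : ℝ :=
  (1 / (k : ℝ)) * ∑ i, f ((z i).1 / σ, (z i).2 / σ)

/-- `∫_{(0,∞)²} f dH_{ρ,α₀,1}`. -/
def limitMean (ρ : ℝ → ℝ) (α₀ : ℝ) (f : ℝ × ℝ → ℝ) : ℝ :=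
  ∫ z in Ioi (0 : ℝ) ×ˢ Ioi (0 : ℝ), f z ∂(frechetWelsch ρ α₀ 1)

/-- `(𝔾 f₁, 𝔾 f₂, 𝔾 f₃, 𝔾 f₄)` with scaling `v`. -/
def empProc {k : ℕ} (z : Fin k → ℝ × ℝ) (ρ : ℝ → ℝ) (α₀ σ v : ℝ) (j : Fin 4) : ℝ :=
  v * (empMean z σ (testFun (alphaOne (ρ 0) α₀) j) -
    limitMean ρ α₀ (testFun (alphaOne (ρ 0) α₀) j))

/-- The law of large numbers on `ℱ₂(α₋, α₊)` together with the joint weak convergence of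
`(𝔾ₙ f₁, …, 𝔾ₙ f₄)` to `W`. -/
structure AsymptoticCondition {Ω : ℕ → Type*} [∀ n, MeasurableSpace (Ω n)]
    (P : ∀ n, Measure (Ω n)) [∀ n, IsProbabilityMeasure (P n)]
    {Ω' : Type*} [MeasurableSpace Ω'] (P' : Measure Ω') [IsProbabilityMeasure P']
    {k : ℕ → ℕ} (Z : ∀ n, Ω n → Fin (k n) → ℝ × ℝ)
    (ρ : ℝ → ℝ) (α₀ : ℝ) (σ : ℕ → ℝ) (αm αp : ℝ) (v : ℕ → ℝ) (W : Ω' → Fin 4 → ℝ) : Prop where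
  welsch : IsWelschFunction ρ
  alpha_pos : 0 < α₀
  sigma_pos : ∀ n, 0 < σ n
  lower_pos : 0 < αm
  lower_lt : αm < alphaOne (ρ 0) α₀
  lt_upper : alphaOne (ρ 0) α₀ < αp
  lln : ∀ f ∈ classF2 αm αp,
    TendstoInDistribution (fun n ω => empMean (Z n ω) (σ n) f) atTop
      (fun _ : Ω' => limitMean ρ α₀ f) P P'
  rate_pos : ∀ n, 0 < v n
  rate_tendsto : Tendsto v atTop atTop
  weak_limit : TendstoInDistribution (fun n ω => empProc (Z n ω) ρ α₀ (σ n) (v n)) atTop W P P'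

end

/-! For fixed `α` the log-likelihood is maximal in the scale exactly when `σ ^ α` times the
empirical mean of `y ^ (-α)` equals `2`. What remains is a profile likelihood in `α` whose
derivative, the score, is strictly decreasing by Cauchy-Schwarz. Hence a maximizer exists as soon as
the pairs do not all coincide, `α̂` is the unique zero of the score, and `σ̂` is an explicit
function of `α̂` (`exists_isMLE`, `shapeMLE_scaleMLE_spec`). The score is also scale invariant, so
the data may be divided by `σ n`.

Under `H` the variable `Y ^ (-α₀)` has density `e ^ (-t) (1 - ρ₀ + ρ₀ t)`, and `Υ` is the moment
generating function of its logarithm. All limiting means are therefore derivatives of `Υ`, and the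
score at `α` tends in probability to `(2 / α₀) Π(α / α₀)`. As `Π` is strictly decreasing with zero
`ϖ`, monotonicity of the score alone gives `α̂ → α₁`; no uniform convergence is needed
(`AsymptoticCondition.tendsto_shapeMLE`).

For the rate, the empirical moments at `α̂` are written through divided differences as their values
at `α₁` plus a slope times `α̂ - α₁`. The score equation becomes an exact linear identity: `α̂ - α₁`
is a combination of the four errors (empirical mean of `f_j` minus limiting mean), with random
coefficients converging in probability to the first row of the matrix. Divided differences of `log`
and `exp` do the same for the scale and the second row (`exists_linearization`). Multiplying by `v
n` and replacing the coefficients by their limits costs a null sequence times a tight one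
(`AsymptoticCondition.tendsto_remainder`); Slutsky's lemma finishes the proof.

Convergence in probability to a constant is encoded as convergence along the filter `probFilter`, so
that the ordinary calculus of limits applies although the probability space changes with `n`. -/

section Moments

/-! ### Moments of the limit distribution as derivatives of `Υ`. -/

open ProbabilityTheory

/-- The mixture of the `Exp(1)` and `Gamma(2,1)` distributions with weights `1 - r` and `r`. -/
noncomputable def momentLaw (r : ℝ) : Measure ℝ :=
  (volume.restrict (Ioi 0)).withDensity
    (fun t => ENNReal.ofReal (Real.exp (-t) * (1 - r + r * t)))

theorem momentLaw_Ici {r : ℝ} (hr : r ∈ Icc (0 : ℝ) 1) (t : ℝ) :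
    momentLaw r (Ici t) =
      ENNReal.ofReal (Real.exp (-(max t 0)) * (1 + r * max t 0)) := by
  set s := max t 0 with hs
  have hs0 : 0 ≤ s := le_max_right _ _
  have hder : ∀ x ∈ Ioi s, HasDerivAt (fun t => -(Real.exp (-t) * (1 + r * t)))
      (Real.exp (-x) * (1 - r + r * x)) x := by
    intro x _
    have h1 : HasDerivAt (fun t : ℝ => Real.exp (-t)) (-Real.exp (-x)) x := by
      simpa using (hasDerivAt_neg x).exp
    have h2 : HasDerivAt (fun t : ℝ => 1 + r * t) r x := by
      simpa using ((hasDerivAt_id x).const_mul r).const_add 1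
    exact (h1.mul h2).neg.congr_deriv (by ring)
  have hnn : ∀ x ∈ Ioi s, 0 ≤ Real.exp (-x) * (1 - r + r * x) := by
    intro x hx
    have : 0 < x := hs0.trans_lt hx
    have := mul_nonneg hr.1 this.le
    exact mul_nonneg (Real.exp_pos _).le (by linarith [hr.2])
  have hlim : Tendsto (fun t : ℝ => -(Real.exp (-t) * (1 + r * t))) atTop (𝓝 0) := by
    have h1 := Real.tendsto_pow_mul_exp_neg_atTop_nhds_zero 0
    have h2 := (Real.tendsto_pow_mul_exp_neg_atTop_nhds_zero 1).const_mul r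
    have := (h1.add h2).neg
    simp only [pow_zero, one_mul, pow_one, mul_zero, add_zero, neg_zero] at this
    refine this.congr fun x => ?_
    ring
  have hcont : ContinuousWithinAt (fun t : ℝ => -(Real.exp (-t) * (1 + r * t))) (Ici s) s := by
    apply Continuous.continuousWithinAt; fun_prop
  have hint := integral_Ioi_of_hasDerivAt_of_nonneg hcont hder hnn hlim
  have hi := integrableOn_Ioi_deriv_of_nonneg hcont hder hnn hlim
  rw [momentLaw, withDensity_apply _ measurableSet_Ici, Measure.restrict_restrict measurableSet_Ici]
  have hset : (Ici t ∩ Ioi 0 : Set ℝ) =ᵐ[volume] Ioi s := by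
    have h1 : (Ici t : Set ℝ) =ᵐ[volume] Ioi t := Ioi_ae_eq_Ici.symm
    have h2 := h1.inter (ae_eq_refl (Ioi (0 : ℝ)))
    rwa [Ioi_inter_Ioi] at h2
  rw [Measure.restrict_congr_set hset, ← ofReal_integral_eq_lintegral_ofReal hi, hint]
  · simp
  · filter_upwards [ae_restrict_mem measurableSet_Ioi] with x hx using hnn x hx

theorem momentLaw_exp_mul_log {r : ℝ} (hr : r ∈ Icc (0 : ℝ) 1) {x : ℝ} (hx : -1 < x) :
    Integrable (fun t => Real.exp (x * Real.log t)) (momentLaw r) ∧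
      mgf Real.log (momentLaw r) x = Upsilon r x := by
  have hm : Measurable (fun t => ENNReal.ofReal (Real.exp (-t) * (1 - r + r * t))) := by fun_prop
  have hfin : ∀ᵐ t ∂(volume.restrict (Ioi (0 : ℝ))),
      ENNReal.ofReal (Real.exp (-t) * (1 - r + r * t)) < ⊤ := by simp
  have heq : ∀ t ∈ Ioi (0 : ℝ), (ENNReal.ofReal (Real.exp (-t) * (1 - r + r * t))).toReal •
      Real.exp (x * Real.log t) = r * (Real.exp (-t) * t ^ (x + 2 - 1)) +
        (1 - r) * (Real.exp (-t) * t ^ (x + 1 - 1)) := by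
    intro t (ht : 0 < t)
    have h0 : 0 ≤ Real.exp (-t) * (1 - r + r * t) :=
      mul_nonneg (Real.exp_pos _).le (by nlinarith [hr.1, hr.2])
    have h1 : Real.exp (x * Real.log t) = t ^ x := by
      rw [Real.rpow_def_of_pos ht, mul_comm]
    have h2 : t ^ (x + 2 - 1) = t ^ x * t := by
      rw [show x + 2 - 1 = x + 1 by ring, Real.rpow_add_one ht.ne']
    rw [ENNReal.toReal_ofReal h0, h1, h2, add_sub_cancel_right, smul_eq_mul]
    ring
  have i1 := (Real.GammaIntegral_convergent (s := x + 2) (by linarith)).const_mul r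
  have i2 := (Real.GammaIntegral_convergent (s := x + 1) (by linarith)).const_mul (1 - r)
  have hae := (ae_restrict_iff' (μ := volume) (s := Ioi (0 : ℝ)) measurableSet_Ioi).2
    (Eventually.of_forall heq)
  constructor
  · rw [momentLaw, integrable_withDensity_iff_integrable_smul' hm hfin]
    exact (i1.add i2).congr (hae.mono fun t ht => ht.symm)
  · rw [mgf, momentLaw, integral_withDensity_eq_integral_toReal_smul hm hfin,
      integral_congr_ae hae, integral_add i1 i2, integral_const_mul, integral_const_mul,
      ← Real.Gamma_eq_integral (by linarith), ← Real.Gamma_eq_integral (by linarith), Upsilon]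

/-- Interior points are where the moment generating function may be differentiated under the
integral; this makes every derivative of `Υ` a log-moment of `momentLaw r`. -/
theorem mem_interior_integrableExpSet_momentLaw {r : ℝ} (hr : r ∈ Icc (0 : ℝ) 1) {x : ℝ}
    (hx : -1 < x) : x ∈ interior (integrableExpSet Real.log (momentLaw r)) := by
  rw [mem_interior]
  exact ⟨Ioi (-1), fun y hy => (momentLaw_exp_mul_log hr hy).1, isOpen_Ioi, hx⟩

theorem Upsilon_eventuallyEq_mgf {r : ℝ} (hr : r ∈ Icc (0 : ℝ) 1) {x : ℝ} (hx : -1 < x) :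
    Upsilon r =ᶠ[𝓝 x] mgf Real.log (momentLaw r) := by
  filter_upwards [Ioi_mem_nhds hx] with y hy using (momentLaw_exp_mul_log hr hy).2.symm

theorem iteratedDeriv_Upsilon {r : ℝ} (hr : r ∈ Icc (0 : ℝ) 1) {x : ℝ} (hx : -1 < x) (n : ℕ) :
    iteratedDeriv n (Upsilon r) x =
      ∫ t, Real.log t ^ n * Real.exp (x * Real.log t) ∂momentLaw r := by
  rw [(Upsilon_eventuallyEq_mgf hr hx).iteratedDeriv_eq,
    iteratedDeriv_mgf (mem_interior_integrableExpSet_momentLaw hr hx)]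

theorem hasDerivAt_iteratedDeriv_Upsilon {r : ℝ} (hr : r ∈ Icc (0 : ℝ) 1) {x : ℝ} (hx : -1 < x)
    (n : ℕ) :
    HasDerivAt (iteratedDeriv n (Upsilon r)) (iteratedDeriv (n + 1) (Upsilon r) x) x := by
  rw [iteratedDeriv_Upsilon hr hx]
  refine (hasDerivAt_integral_pow_mul_exp_real
    (mem_interior_integrableExpSet_momentLaw hr hx) n).congr_of_eventuallyEq ?_
  filter_upwards [Ioi_mem_nhds hx] with y hy using iteratedDeriv_Upsilon hr hy n

/-- A distribution on `(0,∞)` with cdf `exp(-y^{-a})(1 + r y^{-a})` becomes `momentLaw r` under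
`y ↦ y^{-a}`. -/
theorem map_rpow_neg_eq_momentLaw {μ : Measure ℝ} [IsProbabilityMeasure μ] {r a : ℝ}
    (hr : r ∈ Icc (0 : ℝ) 1) (ha : 0 < a) (h0 : μ (Iic 0) = 0)
    (h : ∀ y, 0 < y → μ (Iic y) =
      ENNReal.ofReal (Real.exp (-y ^ (-a)) * (1 + r * y ^ (-a)))) :
    μ.map (fun y => y ^ (-a)) = momentLaw r := by
  have hm : Measurable (fun y : ℝ => y ^ (-a)) := by fun_prop
  have hpos : ∀ᵐ y ∂μ, (0 : ℝ) < y := by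
    rw [ae_iff]; simpa [Iic_def] using h0
  have : IsProbabilityMeasure (μ.map (fun y => y ^ (-a))) :=
    Measure.isProbabilityMeasure_map hm.aemeasurable
  refine Measure.ext_of_Ici _ _ fun t => ?_
  rw [Measure.map_apply hm measurableSet_Ici, momentLaw_Ici hr]
  rcases le_or_gt t 0 with ht | ht
  · have : μ ((fun y => y ^ (-a)) ⁻¹' Ici t) = μ univ := by
      apply measure_congr
      filter_upwards [hpos] with y hy
      exact propext ⟨fun _ => trivial, fun _ => ht.trans (Real.rpow_nonneg hy.le _)⟩
    rw [this, max_eq_right ht]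
    simp
  · have hc : 0 < t ^ (-a⁻¹) := Real.rpow_pos_of_pos ht _
    have e : (t ^ (-a⁻¹)) ^ (-a) = t := by
      rw [← Real.rpow_mul ht.le, neg_mul_neg, inv_mul_cancel₀ ha.ne', Real.rpow_one]
    have : μ ((fun y => y ^ (-a)) ⁻¹' Ici t) = μ (Iic (t ^ (-a⁻¹))) := by
      apply measure_congr
      filter_upwards [hpos] with y hy
      refine propext ?_
      change t ≤ y ^ (-a) ↔ y ≤ t ^ (-a⁻¹)
      rw [← Real.rpow_le_rpow_iff_of_neg (y := y) hc hy (neg_lt_zero.2 ha), e]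
    rw [this, h _ hc, e, max_eq_left ht.le]

/-- Moments of a distribution on `(0,∞)` with cdf `exp(-y^{-a})(1 + r y^{-a})`. -/
theorem integral_rpow_mul_log_pow {μ : Measure ℝ} [IsProbabilityMeasure μ] {r a : ℝ}
    (hr : r ∈ Icc (0 : ℝ) 1) (ha : 0 < a) (h0 : μ (Iic 0) = 0)
    (h : ∀ y, 0 < y → μ (Iic y) =
      ENNReal.ofReal (Real.exp (-y ^ (-a)) * (1 + r * y ^ (-a))))
    {α : ℝ} (hα : 0 ≤ α) (m : ℕ) :
    ∫ y, y ^ (-α) * Real.log y ^ m ∂μ =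
      (-1 / a) ^ m * iteratedDeriv m (Upsilon r) (α / a) := by
  have hm : Measurable (fun y : ℝ => y ^ (-a)) := by fun_prop
  have hpos : ∀ᵐ y ∂μ, (0 : ℝ) < y := by
    rw [ae_iff]; simpa [Iic_def] using h0
  have hx : -1 < α / a := by
    have := div_nonneg hα ha.le
    linarith
  rw [iteratedDeriv_Upsilon hr hx, ← map_rpow_neg_eq_momentLaw hr ha h0 h,
    integral_map hm.aemeasurable (by fun_prop), ← integral_const_mul]
  refine integral_congr_ae ?_
  filter_upwards [hpos] with y hy
  -- The last rewrite replaces every `Real.log y`, also those that were already in the right form;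
  -- `this` below removes the surplus factor.
  rw [Real.log_rpow hy, Real.rpow_def_of_pos hy,
    show α / a * (-a * Real.log y) = Real.log y * -α by field_simp,
    show Real.log y = -1 / a * (-a * Real.log y) by field_simp]
  rw [mul_pow (-1 / a)]
  have : -a * (-1 / a * (-a * Real.log y)) = -a * Real.log y := by field_simp
  rw [this]
  ring

/-! ### Marginals of the Fréchet-Welsch distribution. -/

section Marginals

variable {ρ : ℝ → ℝ} {α₀ : ℝ}

theorem frechetWelsch_Iic_prod_univ (h : IsWelschFunction ρ) (hα : 0 < α₀) {x : ℝ} (hx : 0 < x) :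
    frechetWelsch ρ α₀ 1 (Iic x ×ˢ univ) = ENNReal.ofReal (Real.exp (-x ^ (-α₀))) := by
  obtain ⟨_, hH⟩ := isFrechetWelsch_frechetWelsch h hα one_pos
  have hmono : Monotone fun n : ℕ => Iic x ×ˢ Iic (n : ℝ) := fun a b hab =>
    prod_mono le_rfl (Iic_subset_Iic.2 (by exact_mod_cast hab))
  have hU : ⋃ n : ℕ, Iic x ×ˢ Iic (n : ℝ) = Iic x ×ˢ univ := by
    rw [← prod_iUnion, iUnion_Iic_of_not_bddAbove_range]
    exact not_bddAbove_iff.2 fun y => by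
      obtain ⟨n, hn⟩ := exists_nat_gt y
      exact ⟨n, ⟨n, rfl⟩, hn⟩
  have ht := tendsto_measure_iUnion_atTop (μ := frechetWelsch ρ α₀ 1) hmono
  rw [hU] at ht
  refine tendsto_nhds_unique ht (tendsto_const_nhds.congr' ?_)
  obtain ⟨N, hN⟩ := exists_nat_gt x
  filter_upwards [eventually_ge_atTop N] with n hn
  have hn' : x ≤ n := hN.le.trans (by exact_mod_cast hn)
  simp only [Function.comp_apply]
  rw [hH, frechetWelschCDF, if_neg (by push Not; exact ⟨hx, hx.trans_le hn'⟩), if_pos hn', div_one]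

/-- As `x → ∞` the argument `(y / x) ^ α₀` of `ρ` tends to `0`, and `ρ` is continuous there from
within `[0,1]`. This is why only `ρ 0` survives in all limiting quantities. -/
theorem frechetWelsch_univ_prod_Iic (h : IsWelschFunction ρ) (hα : 0 < α₀) {y : ℝ} (hy : 0 < y) :
    frechetWelsch ρ α₀ 1 (univ ×ˢ Iic y) =
      ENNReal.ofReal (Real.exp (-y ^ (-α₀)) * (1 + ρ 0 * y ^ (-α₀))) := by
  obtain ⟨_, hH⟩ := isFrechetWelsch_frechetWelsch h hα one_pos
  have hmono : Monotone fun n : ℕ => Iic (n : ℝ) ×ˢ Iic y := fun a b hab =>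
    prod_mono (Iic_subset_Iic.2 (by exact_mod_cast hab)) le_rfl
  have hU : ⋃ n : ℕ, Iic (n : ℝ) ×ˢ Iic y = univ ×ˢ Iic y := by
    rw [← iUnion_prod_const, iUnion_Iic_of_not_bddAbove_range]
    exact not_bddAbove_iff.2 fun y => by
      obtain ⟨n, hn⟩ := exists_nat_gt y
      exact ⟨n, ⟨n, rfl⟩, hn⟩
  have ht := tendsto_measure_iUnion_atTop (μ := frechetWelsch ρ α₀ 1) hmono
  rw [hU] at ht
  obtain ⟨N, hN⟩ := exists_nat_gt y
  have hq : Tendsto (fun n : ℕ => (y / n) ^ α₀) atTop (𝓝[Icc 0 1] 0) := by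
    refine tendsto_nhdsWithin_iff.2 ⟨?_, ?_⟩
    · have h1 : Tendsto (fun n : ℕ => y / n) atTop (𝓝 0) :=
        tendsto_const_nhds.div_atTop tendsto_natCast_atTop_atTop
      have := h1.rpow_const (p := α₀) (Or.inr hα.le)
      rwa [Real.zero_rpow hα.ne'] at this
    · filter_upwards [eventually_ge_atTop N] with n hn
      have hn' : y < n := hN.trans_le (by exact_mod_cast hn)
      have : 0 < (n : ℝ) := hy.trans hn'
      exact ⟨by positivity, Real.rpow_le_one (by positivity) ((div_le_one this).2 hn'.le) hα.le⟩
  have hρ : Tendsto (fun n : ℕ => ρ ((y / n) ^ α₀)) atTop (𝓝 (ρ 0)) :=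
    (h.continuousOn 0 (by simp)).tendsto.comp hq
  have hl : Tendsto (fun n : ℕ => ENNReal.ofReal
      (Real.exp (-y ^ (-α₀)) * (1 + ρ ((y / n) ^ α₀) * y ^ (-α₀)))) atTop
      (𝓝 (ENNReal.ofReal (Real.exp (-y ^ (-α₀)) * (1 + ρ 0 * y ^ (-α₀))))) :=
    ENNReal.tendsto_ofReal (((hρ.mul_const _).const_add _).const_mul _)
  refine tendsto_nhds_unique ht (hl.congr' ?_)
  filter_upwards [eventually_ge_atTop N] with n hn
  have hn' : y < n := hN.trans_le (by exact_mod_cast hn)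
  simp only [Function.comp_apply]
  rw [hH, frechetWelschCDF, if_neg (by push Not; exact ⟨hy.trans hn', hy⟩), if_neg hn'.not_ge,
    div_one]

theorem frechetWelsch_fst_nonpos (h : IsWelschFunction ρ) (hα : 0 < α₀) :
    frechetWelsch ρ α₀ 1 (Iic 0 ×ˢ univ) = 0 := by
  obtain ⟨_, hH⟩ := isFrechetWelsch_frechetWelsch h hα one_pos
  have hU : Iic (0 : ℝ) ×ˢ univ ⊆ ⋃ n : ℕ, Iic (0 : ℝ) ×ˢ Iic (n : ℝ) := by
    rintro ⟨a, b⟩ ⟨ha, _⟩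
    obtain ⟨n, hn⟩ := exists_nat_gt b
    exact mem_iUnion.2 ⟨n, ha, hn.le⟩
  refine measure_mono_null hU (measure_iUnion_null fun n => ?_)
  rw [hH, frechetWelschCDF, if_pos (Or.inl le_rfl), ENNReal.ofReal_zero]

theorem frechetWelsch_snd_nonpos (h : IsWelschFunction ρ) (hα : 0 < α₀) :
    frechetWelsch ρ α₀ 1 (univ ×ˢ Iic 0) = 0 := by
  obtain ⟨_, hH⟩ := isFrechetWelsch_frechetWelsch h hα one_pos
  have hU : univ ×ˢ Iic (0 : ℝ) ⊆ ⋃ n : ℕ, Iic (n : ℝ) ×ˢ Iic (0 : ℝ) := by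
    rintro ⟨a, b⟩ ⟨_, hb⟩
    obtain ⟨n, hn⟩ := exists_nat_gt a
    exact mem_iUnion.2 ⟨n, hn.le, hb⟩
  refine measure_mono_null hU (measure_iUnion_null fun n => ?_)
  rw [hH, frechetWelschCDF, if_pos (Or.inr le_rfl), ENNReal.ofReal_zero]

theorem limitMean_eq_integral (h : IsWelschFunction ρ) (hα : 0 < α₀) (f : ℝ × ℝ → ℝ) :
    limitMean ρ α₀ f = ∫ z, f z ∂(frechetWelsch ρ α₀ 1) := by
  rw [limitMean, Measure.restrict_eq_self_of_ae_mem]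
  rw [ae_iff]
  refine measure_mono_null (fun z hz => ?_)
    (measure_union_null (frechetWelsch_fst_nonpos h hα) (frechetWelsch_snd_nonpos h hα))
  by_contra hc
  simp only [mem_union, mem_prod, mem_Iic, mem_univ, and_true, true_and, not_or, not_le] at hc
  exact hz hc

theorem limitMean_rpow_mul_log_pow (h : IsWelschFunction ρ) (hα : 0 < α₀) {α : ℝ} (hα0 : 0 ≤ α)
    (m : ℕ) : limitMean ρ α₀ (fun z => z.2 ^ (-α) * Real.log z.2 ^ m) =
      (-1 / α₀) ^ m * iteratedDeriv m (Upsilon (ρ 0)) (α / α₀) := by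
  obtain ⟨hP, -⟩ := isFrechetWelsch_frechetWelsch h hα one_pos
  have : IsProbabilityMeasure ((frechetWelsch ρ α₀ 1).map Prod.snd) :=
    Measure.isProbabilityMeasure_map measurable_snd.aemeasurable
  have key : ∀ y : ℝ, (frechetWelsch ρ α₀ 1).map Prod.snd (Iic y) =
      frechetWelsch ρ α₀ 1 (univ ×ˢ Iic y) := fun y => by
    rw [Measure.map_apply measurable_snd measurableSet_Iic, univ_prod]
  rw [limitMean_eq_integral h hα,
    ← integral_rpow_mul_log_pow (μ := (frechetWelsch ρ α₀ 1).map Prod.snd)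
      (h.mapsTo (by simp : (0 : ℝ) ∈ Icc 0 1)) hα
      (by rw [key, frechetWelsch_snd_nonpos h hα])
      (fun y hy => by rw [key, frechetWelsch_univ_prod_Iic h hα hy]) hα0 m,
    integral_map measurable_snd.aemeasurable
      (by apply Measurable.aestronglyMeasurable; fun_prop)]

theorem limitMean_log_snd (h : IsWelschFunction ρ) (hα : 0 < α₀) :
    limitMean ρ α₀ (fun z => Real.log z.2) = -1 / α₀ * deriv (Upsilon (ρ 0)) 0 := by
  have := limitMean_rpow_mul_log_pow h hα le_rfl 1
  simpa [iteratedDeriv_one] using this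

/-- The first marginal is a plain Fréchet law, hence the case `r = 0` of the moment formula. -/
theorem limitMean_log_fst (h : IsWelschFunction ρ) (hα : 0 < α₀) :
    limitMean ρ α₀ (fun z => Real.log z.1) = -1 / α₀ * deriv (Upsilon 0) 0 := by
  obtain ⟨hP, -⟩ := isFrechetWelsch_frechetWelsch h hα one_pos
  have : IsProbabilityMeasure ((frechetWelsch ρ α₀ 1).map Prod.fst) :=
    Measure.isProbabilityMeasure_map measurable_fst.aemeasurable
  have key : ∀ y : ℝ, (frechetWelsch ρ α₀ 1).map Prod.fst (Iic y) =
      frechetWelsch ρ α₀ 1 (Iic y ×ˢ univ) := fun y => by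
    rw [Measure.map_apply measurable_fst measurableSet_Iic, prod_univ]
  have e := integral_rpow_mul_log_pow (μ := (frechetWelsch ρ α₀ 1).map Prod.fst) (r := 0)
      (by simp) hα
      (by rw [key, frechetWelsch_fst_nonpos h hα])
      (fun y hy => by rw [key, frechetWelsch_Iic_prod_univ h hα hy]; simp) le_rfl 1
  rw [integral_map measurable_fst.aemeasurable
      (by apply Measurable.aestronglyMeasurable; fun_prop)] at e
  rw [limitMean_eq_integral h hα]
  simpa [iteratedDeriv_one] using e

end Marginals

/-! ### Log-convexity of `Υ` and the zero of `Π`. -/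

theorem Upsilon_pos {r x : ℝ} (hr : r ∈ Icc (0 : ℝ) 1) (hx : -1 < x) : 0 < Upsilon r x := by
  have h1 : 0 < Real.Gamma (x + 2) := Real.Gamma_pos_of_pos (by linarith)
  have h2 : 0 < Real.Gamma (x + 1) := Real.Gamma_pos_of_pos (by linarith)
  rw [Upsilon]
  rcases eq_or_lt_of_le hr.1 with h | h
  · rw [← h]; simpa using h2
  · have := mul_nonneg (sub_nonneg.2 hr.2) h2.le
    have := mul_pos h h1
    linarith

theorem hasDerivAt_Upsilon {r x : ℝ} (hr : r ∈ Icc (0 : ℝ) 1) (hx : -1 < x) :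
    HasDerivAt (Upsilon r) (deriv (Upsilon r) x) x := by
  have := hasDerivAt_iteratedDeriv_Upsilon hr hx 0
  simpa [iteratedDeriv_one] using this

theorem hasDerivAt_deriv_Upsilon {r x : ℝ} (hr : r ∈ Icc (0 : ℝ) 1) (hx : -1 < x) :
    HasDerivAt (deriv (Upsilon r)) (deriv (deriv (Upsilon r)) x) x := by
  have := hasDerivAt_iteratedDeriv_Upsilon hr hx 1
  simpa [iteratedDeriv_succ] using this

/-- `Υ` is log-convex. -/
theorem sq_deriv_Upsilon_le {r x : ℝ} (hr : r ∈ Icc (0 : ℝ) 1) (hx : -1 < x) :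
    deriv (Upsilon r) x ^ 2 ≤ deriv (deriv (Upsilon r)) x * Upsilon r x := by
  have hU := Upsilon_pos hr hx
  have hint := fun n => integrable_pow_mul_exp_of_mem_interior_integrableExpSet
    (mem_interior_integrableExpSet_momentLaw hr hx) n
  have e0 := iteratedDeriv_Upsilon hr hx 0
  have e1 := iteratedDeriv_Upsilon hr hx 1
  have e2 := iteratedDeriv_Upsilon hr hx 2
  simp only [iteratedDeriv_succ, iteratedDeriv_zero] at e0 e1 e2
  -- Cauchy-Schwarz for the weight `exp (x log t)`: the integral of `(log t + a) ^ 2` is a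
  -- nonnegative quadratic in `a`, evaluated below at its minimizer `-Υ' / Υ`.
  have key : ∀ a : ℝ, 0 ≤ deriv (deriv (Upsilon r)) x + 2 * a * deriv (Upsilon r) x +
      a ^ 2 * Upsilon r x := by
    intro a
    have h0 : 0 ≤ ∫ t, (Real.log t + a) ^ 2 * Real.exp (x * Real.log t) ∂momentLaw r :=
      integral_nonneg fun t => by positivity
    have : ∀ t, (Real.log t + a) ^ 2 * Real.exp (x * Real.log t) =
        Real.log t ^ 2 * Real.exp (x * Real.log t) +
          2 * a * (Real.log t ^ 1 * Real.exp (x * Real.log t)) +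
          a ^ 2 * (Real.log t ^ 0 * Real.exp (x * Real.log t)) := fun t => by ring
    simp only [this] at h0
    have i12 : Integrable (fun t => Real.log t ^ 2 * Real.exp (x * Real.log t) +
        2 * a * (Real.log t ^ 1 * Real.exp (x * Real.log t))) (momentLaw r) :=
      (hint 2).add ((hint 1).const_mul _)
    rwa [integral_add i12 ((hint 0).const_mul _),
      integral_add (hint 2) ((hint 1).const_mul _), integral_const_mul, integral_const_mul,
      ← e0, ← e1, ← e2] at h0
  have h := key (-(deriv (Upsilon r) x / Upsilon r x))
  have h' := mul_nonneg h hU.le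
  have e : (deriv (deriv (Upsilon r)) x + 2 * -(deriv (Upsilon r) x / Upsilon r x) *
      deriv (Upsilon r) x + (-(deriv (Upsilon r) x / Upsilon r x)) ^ 2 * Upsilon r x) *
        Upsilon r x = deriv (deriv (Upsilon r)) x * Upsilon r x - deriv (Upsilon r) x ^ 2 := by
    field_simp
    ring
  linarith

theorem hasDerivAt_PiFun {r y : ℝ} (hr : r ∈ Icc (0 : ℝ) 1) (hy : 0 < y) :
    HasDerivAt (PiFun r) (-1 / y ^ 2 - (deriv (deriv (Upsilon r)) y * Upsilon r y -
      deriv (Upsilon r) y ^ 2) / Upsilon r y ^ 2) y := by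
  have hx : -1 < y := by linarith
  have hU := (Upsilon_pos hr hx).ne'
  have h1 := (hasDerivAt_deriv_Upsilon hr hx).div (hasDerivAt_Upsilon hr hx) hU
  have h2 : HasDerivAt (fun y : ℝ => 1 / y) (-1 / y ^ 2) y := by
    simpa [neg_div] using hasDerivAt_inv hy.ne'
  have := ((h2.sub h1).add_const (r / 2)).sub_const Real.eulerMascheroniConstant
  exact this.congr_deriv (by ring)

theorem deriv_PiFun_neg {r y : ℝ} (hr : r ∈ Icc (0 : ℝ) 1) (hy : 0 < y) :
    -1 / y ^ 2 - (deriv (deriv (Upsilon r)) y * Upsilon r y -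
      deriv (Upsilon r) y ^ 2) / Upsilon r y ^ 2 < 0 := by
  have hx : -1 < y := by linarith
  have h1 := sq_deriv_Upsilon_le hr hx
  have h2 : -1 / y ^ 2 < 0 := div_neg_of_neg_of_pos (by norm_num) (by positivity)
  have h3 : 0 ≤ (deriv (deriv (Upsilon r)) y * Upsilon r y -
      deriv (Upsilon r) y ^ 2) / Upsilon r y ^ 2 := div_nonneg (by linarith) (by positivity)
  linarith

theorem strictAntiOn_PiFun {r : ℝ} (hr : r ∈ Icc (0 : ℝ) 1) :
    StrictAntiOn (PiFun r) (Ioi 0) := by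
  refine strictAntiOn_of_deriv_neg (convex_Ioi 0)
    (fun y hy => (hasDerivAt_PiFun hr hy).continuousAt.continuousWithinAt) fun y hy => ?_
  rw [interior_Ioi] at hy
  rw [(hasDerivAt_PiFun hr hy).deriv]
  exact deriv_PiFun_neg hr hy

theorem deriv_Upsilon_eq {x : ℝ} (r : ℝ) (hx : -1 < x) :
    deriv (Upsilon r) x = r * deriv Real.Gamma (x + 2) + (1 - r) * deriv Real.Gamma (x + 1) := by
  have hd : ∀ s : ℝ, 0 < s → HasDerivAt Real.Gamma (deriv Real.Gamma s) s := fun s hs =>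
    (Real.differentiableAt_Gamma fun m => by
      have : (0 : ℝ) ≤ m := m.cast_nonneg
      linarith).hasDerivAt
  have h1 := ((hd (x + 2) (by linarith)).comp_add_const x 2).const_mul r
  have h2 := ((hd (x + 1) (by linarith)).comp_add_const x 1).const_mul (1 - r)
  exact (h1.add h2).deriv

theorem deriv_Upsilon_zero (r : ℝ) :
    deriv (Upsilon r) 0 = r - Real.eulerMascheroniConstant := by
  have h1 := Real.deriv_Gamma_nat 1
  have h0 := Real.deriv_Gamma_nat 0
  rw [deriv_Upsilon_eq r (by norm_num)]
  norm_num at h1 h0 ⊢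
  rw [h1, h0]
  ring

theorem deriv_Upsilon_one (r : ℝ) :
    deriv (Upsilon r) 1 = 1 + 2 * r - Real.eulerMascheroniConstant * (1 + r) := by
  have h1 := Real.deriv_Gamma_nat 1
  have h2 := Real.deriv_Gamma_nat 2
  rw [deriv_Upsilon_eq r (by norm_num)]
  norm_num [harmonic_succ, Nat.factorial] at h1 h2 ⊢
  rw [h1, h2]
  ring

theorem Upsilon_zero (r : ℝ) : Upsilon r 0 = 1 := by
  norm_num [Upsilon, Real.Gamma_two]

theorem Upsilon_one (r : ℝ) : Upsilon r 1 = 1 + r := by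
  have h : Real.Gamma 3 = 2 := by
    have := Real.Gamma_nat_eq_factorial 2
    norm_num only [Nat.factorial] at this
    exact this
  norm_num [Upsilon, h, Real.Gamma_two]
  ring

/-- This value is nonpositive on `[0,1]`, which gives the right end of the interval containing `ϖ`;
it vanishes at `r = 1`, so that `ϖ = 1` there. -/
theorem PiFun_one {r : ℝ} (hr : r ∈ Icc (0 : ℝ) 1) :
    PiFun r 1 = r * (r - 1) / (2 * (1 + r)) := by
  have : 1 + r ≠ 0 := by linarith [hr.1]
  rw [PiFun, deriv_Upsilon_one, Upsilon_one]
  field_simp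
  ring

theorem exists_PiFun_eq_zero {r : ℝ} (hr : r ∈ Icc (0 : ℝ) 1) : ∃ y, 0 < y ∧ PiFun r y = 0 := by
  have h1 : PiFun r 1 ≤ 0 := by
    rw [PiFun_one hr]
    exact div_nonpos_of_nonpos_of_nonneg (mul_nonpos_of_nonneg_of_nonpos hr.1 (by linarith [hr.2]))
      (by linarith [hr.1])
  have hc : ContinuousAt (fun y => deriv (Upsilon r) y / Upsilon r y - r / 2 +
      Real.eulerMascheroniConstant) 0 :=
    ((((hasDerivAt_deriv_Upsilon hr (by norm_num)).continuousAt).div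
      (hasDerivAt_Upsilon hr (by norm_num)).continuousAt
      (Upsilon_pos hr (by norm_num)).ne').sub continuousAt_const).add continuousAt_const
  -- Near `0` the function `Π` is `1 / y` minus a function continuous at `0`.
  have ht : Tendsto (PiFun r) (𝓝[>] 0) atTop := by
    have := tendsto_inv_nhdsGT_zero (𝕜 := ℝ) |>.atTop_add
      (hc.tendsto.mono_left nhdsWithin_le_nhds).neg
    refine this.congr fun y => ?_
    simp only [PiFun]
    ring
  obtain ⟨b, hb, hb0, hb1⟩ := ((ht.eventually_ge_atTop 0).and
    (Ioo_mem_nhdsGT (zero_lt_one (α := ℝ)))).exists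
  have hcont : ContinuousOn (PiFun r) (Icc b 1) := fun y hy =>
    (hasDerivAt_PiFun hr (hb0.trans_le hy.1)).continuousAt.continuousWithinAt
  obtain ⟨y, hy, e⟩ := intermediate_value_Icc' hb1.le hcont ⟨h1, hb⟩
  exact ⟨y, hb0.trans_le hy.1, e⟩

theorem varpi_pos {r : ℝ} (hr : r ∈ Icc (0 : ℝ) 1) : 0 < varpi r :=
  (Classical.epsilon_spec (exists_PiFun_eq_zero hr)).1

theorem PiFun_varpi {r : ℝ} (hr : r ∈ Icc (0 : ℝ) 1) : PiFun r (varpi r) = 0 :=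
  (Classical.epsilon_spec (exists_PiFun_eq_zero hr)).2

theorem varpi_one : varpi 1 = 1 := by
  have hr : (1 : ℝ) ∈ Icc (0 : ℝ) 1 := by simp
  refine (strictAntiOn_PiFun hr).injOn (varpi_pos hr) (mem_Ioi.2 one_pos) ?_
  rw [PiFun_varpi hr, PiFun_one hr]
  norm_num

theorem alphaOne_pos {r α₀ : ℝ} (hr : r ∈ Icc (0 : ℝ) 1) (hα : 0 < α₀) : 0 < alphaOne r α₀ :=
  mul_pos (varpi_pos hr) hα

theorem psiDot_neg {r α₀ : ℝ} (hr : r ∈ Icc (0 : ℝ) 1) (hα : 0 < α₀) : psiDot r α₀ < 0 := by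
  have hv := varpi_pos hr
  have hU := Upsilon_pos hr (show -1 < varpi r by linarith)
  have h := deriv_PiFun_neg hr hv
  have : psiDot r α₀ = 2 / α₀ ^ 2 * (-1 / varpi r ^ 2 -
      (deriv (deriv (Upsilon r)) (varpi r) * Upsilon r (varpi r) -
      deriv (Upsilon r) (varpi r) ^ 2) / Upsilon r (varpi r) ^ 2) := by
    rw [psiDot, alphaOne]
    field_simp
  rw [this]
  exact mul_neg_of_pos_of_neg (by positivity) h

/-! ### Second derivatives of the Gamma function and the explicit matrix for `ρ₀ = 1`. -/

theorem Upsilon_zero_mul_neg_mul_sin {x : ℝ} (hx : x ∈ Ioo (-1 : ℝ) 1) :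
    Upsilon 0 x * Upsilon 0 (-x) * Real.sin (Real.pi * x) = Real.pi * x := by
  -- The point `0` is separate because `Γ(x + 1) = x Γ(x)` and the reflection formula are used with
  -- `x ≠ 0` and `sin (π x) ≠ 0`.
  by_cases h0 : x = 0
  · simp [h0]
  have hs : Real.sin (Real.pi * x) ≠ 0 := by
    intro h
    obtain ⟨n, hn⟩ := Real.sin_eq_zero_iff.1 h
    have hxn : (n : ℝ) = x := by
      have := Real.pi_pos.ne'
      field_simp at hn
      linarith
    have a : -1 < n := by exact_mod_cast hxn ▸ hx.1
    have b : n < 1 := by exact_mod_cast hxn ▸ hx.2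
    have : n = 0 := by omega
    exact h0 (by rw [← hxn, this]; simp)
  have e := Real.Gamma_mul_Gamma_one_sub x
  rw [eq_div_iff hs] at e
  simp only [Upsilon, zero_mul, zero_add, sub_zero, one_mul]
  rw [Real.Gamma_add_one h0, show -x + 1 = 1 - x by ring]
  linear_combination x * e

/-- The value `Γ''(1) = γ² + π²/6`. -/
theorem deriv_deriv_Upsilon_zero_zero :
    deriv (deriv (Upsilon 0)) 0 = Real.eulerMascheroniConstant ^ 2 + Real.pi ^ 2 / 6 := by
  have hr : (0 : ℝ) ∈ Icc (0 : ℝ) 1 := by simp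
  set g : ℕ → ℝ → ℝ := fun n => iteratedDeriv n (Upsilon 0) with hg
  have hd : ∀ n x, x ∈ Ioo (-1 : ℝ) 1 → HasDerivAt (g n) (g (n + 1) x) x := fun n x hx =>
    hasDerivAt_iteratedDeriv_Upsilon hr hx.1 n
  have hdn : ∀ n x, x ∈ Ioo (-1 : ℝ) 1 → HasDerivAt (fun x => g n (-x)) (-g (n + 1) (-x)) x := by
    intro n x hx
    have h := hd n (-x) ⟨by linarith [hx.2], by linarith [hx.1]⟩
    exact (h.scomp x (hasDerivAt_neg x)).congr_deriv (by simp)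
  have hs : ∀ x, HasDerivAt (fun x => Real.sin (Real.pi * x)) (Real.pi * Real.cos (Real.pi * x)) x := by
    intro x
    have := ((hasDerivAt_id x).const_mul Real.pi).sin
    simpa [mul_comm] using this
  have hc : ∀ x, HasDerivAt (fun x => Real.cos (Real.pi * x)) (-(Real.pi * Real.sin (Real.pi * x))) x := by
    intro x
    have := ((hasDerivAt_id x).const_mul Real.pi).cos
    simpa [mul_comm] using this
  -- Differentiating an identity on `(-1,1)`. The identity `Γ(1+x) Γ(1-x) sin (π x) = π x` is
  -- differentiated three times; with `B(x) = Γ(1+x) Γ(1-x)` the third derivative at `0` reads `3 π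
  -- B''(0) - π ^ 3 = 0`, where `B''(0) = 2 (Γ''(1) - γ ^ 2)`.
  have step : ∀ {F G F' G' : ℝ → ℝ}, (∀ x ∈ Ioo (-1 : ℝ) 1, F x = G x) →
      (∀ x ∈ Ioo (-1 : ℝ) 1, HasDerivAt F (F' x) x) → (∀ x ∈ Ioo (-1 : ℝ) 1, HasDerivAt G (G' x) x) →
      ∀ x ∈ Ioo (-1 : ℝ) 1, F' x = G' x := by
    intro F G F' G' h hF hG x hx
    refine (hF x hx).unique ((hG x hx).congr_of_eventuallyEq ?_)
    filter_upwards [Ioo_mem_nhds hx.1 hx.2] with y hy using h y hy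
  have s0 : ∀ x ∈ Ioo (-1 : ℝ) 1, g 0 x * g 0 (-x) * Real.sin (Real.pi * x) = Real.pi * x :=
    fun x hx => by simpa [hg] using Upsilon_zero_mul_neg_mul_sin hx
  have hA : ∀ x ∈ Ioo (-1 : ℝ) 1, HasDerivAt (fun x => g 1 x * g 0 (-x) + g 0 x * -g 1 (-x))
      (g 2 x * g 0 (-x) - 2 * (g 1 x * g 1 (-x)) + g 0 x * g 2 (-x)) x := fun x hx =>
    (((hd 1 x hx).mul (hdn 0 x hx)).add ((hd 0 x hx).mul (hdn 1 x hx).neg)).congr_deriv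
      (by simp; ring)
  have h0 : (0 : ℝ) ∈ Ioo (-1 : ℝ) 1 := by norm_num
  have hB : ∀ x ∈ Ioo (-1 : ℝ) 1, HasDerivAt (fun x => g 0 x * g 0 (-x))
      (g 1 x * g 0 (-x) + g 0 x * -g 1 (-x)) x := fun x hx => (hd 0 x hx).mul (hdn 0 x hx)
  -- The value `c` is irrelevant: it only enters multiplied by `sin 0`.
  obtain ⟨c, hA2⟩ : ∃ c, HasDerivAt (fun x => g 2 x * g 0 (-x) - 2 * (g 1 x * g 1 (-x)) +
      g 0 x * g 2 (-x)) c 0 := ⟨_, (((hd 2 0 h0).mul (hdn 0 0 h0)).sub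
    (((hd 1 0 h0).mul (hdn 1 0 h0)).const_mul 2)).add ((hd 0 0 h0).mul (hdn 2 0 h0))⟩
  have s1 := step s0 (fun x hx => (hB x hx).mul (hs x))
    (fun x _ => (hasDerivAt_id x).const_mul Real.pi)
  have s2 := step s1 (fun x hx => ((hA x hx).mul (hs x)).add
    ((hB x hx).mul ((hc x).const_mul Real.pi))) (fun x _ => hasDerivAt_const x _)
  have h3 := ((hA2.mul (hs 0)).add ((hA 0 h0).mul ((hc 0).const_mul Real.pi))).add
    (((hA 0 h0).mul ((hc 0).const_mul Real.pi)).add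
      ((hB 0 h0).mul (((hs 0).const_mul Real.pi).neg.const_mul Real.pi)))
  have h4 := h3.unique ((hasDerivAt_const (0 : ℝ) (0 : ℝ)).congr_of_eventuallyEq (by
    filter_upwards [Ioo_mem_nhds h0.1 h0.2] with y hy using s2 y hy))
  have g0 : g 0 0 = 1 := by simp [hg, Upsilon_zero]
  have g1 : g 1 0 = -Real.eulerMascheroniConstant := by
    simp [hg, iteratedDeriv_one, deriv_Upsilon_zero]
  have g2 : g 2 0 = deriv (deriv (Upsilon 0)) 0 := by simp [hg, iteratedDeriv_succ]
  simp only [mul_zero, Real.sin_zero, Real.cos_zero, neg_zero, g0, g1] at h4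
  rw [← g2]
  have hpi := Real.pi_pos.ne'
  field_simp
  refine mul_left_cancel₀ hpi ?_
  linarith

/-- The value `Γ''(3)`, obtained from `Γ''(1)` via `Γ(x+2) = (x ^ 2 + x) Γ(x)`; it enters the slope
`D` when `ρ₀ = 1`, since then `ϖ = 1`. -/
theorem deriv_deriv_Upsilon_one_one :
    deriv (deriv (Upsilon 1)) 1 = 2 - 6 * Real.eulerMascheroniConstant +
      2 * Real.eulerMascheroniConstant ^ 2 + Real.pi ^ 2 / 3 := by
  have hr : (0 : ℝ) ∈ Icc (0 : ℝ) 1 := by simp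
  have e0 : ∀ x : ℝ, 0 < x → Upsilon 1 x = (x ^ 2 + x) * Upsilon 0 (x - 1) := by
    intro x hx
    simp only [Upsilon, one_mul, sub_self, zero_mul, add_zero, zero_add, sub_zero, sub_add_cancel]
    rw [show x + 2 = (x + 1) + 1 by ring, Real.Gamma_add_one (by linarith),
      Real.Gamma_add_one hx.ne']
    ring
  have hp : ∀ x : ℝ, HasDerivAt (fun x : ℝ => x ^ 2 + x) (2 * x + 1) x := fun x => by
    exact ((hasDerivAt_pow 2 x).add (hasDerivAt_id x)).congr_deriv (by norm_num)
  have e1 : ∀ x : ℝ, 0 < x → deriv (Upsilon 1) x =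
      (2 * x + 1) * Upsilon 0 (x - 1) + (x ^ 2 + x) * deriv (Upsilon 0) (x - 1) := by
    intro x hx
    have h := (hp x).mul ((hasDerivAt_Upsilon hr (x := x - 1) (by linarith)).comp_sub_const x 1)
    refine (h.congr_of_eventuallyEq ?_).deriv
    filter_upwards [Ioi_mem_nhds hx] with y hy using e0 y hy
  have h1 : HasDerivAt (fun x : ℝ => 2 * x + 1) 2 1 := by
    simpa using ((hasDerivAt_id (1 : ℝ)).const_mul 2).add_const 1
  have h := (h1.mul ((hasDerivAt_Upsilon hr (x := 1 - 1) (by norm_num)).comp_sub_const 1 1)).add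
    ((hp 1).mul ((hasDerivAt_deriv_Upsilon hr (x := 1 - 1) (by norm_num)).comp_sub_const 1 1))
  have h2 := (h.congr_of_eventuallyEq (f₁ := deriv (Upsilon 1)) (by
    filter_upwards [Ioi_mem_nhds one_pos] with y hy using e1 y hy)).deriv
  rw [h2]
  simp only [sub_self, Upsilon_zero, deriv_Upsilon_zero, deriv_deriv_Upsilon_zero_zero]
  ring

theorem alphaOne_one (α₀ : ℝ) : alphaOne 1 α₀ = α₀ := by
  rw [alphaOne, varpi_one, one_mul]

theorem psiDot_one (α₀ : ℝ) : psiDot 1 α₀ = -((2 * Real.pi ^ 2 - 3) / (6 * α₀ ^ 2)) := by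
  rw [psiDot, alphaOne_one, varpi_one, Upsilon_one, deriv_Upsilon_one,
    deriv_deriv_Upsilon_one_one]
  field_simp
  ring

theorem limitMatrix_one {α₀ : ℝ} (hα : 0 < α₀) :
    limitMatrix 1 α₀ = (6 / (2 * Real.pi ^ 2 - 3)) •
        !![α₀ ^ 2, (3 - 2 * Real.eulerMascheroniConstant) / 2 * α₀, -α₀ ^ 2, -α₀ ^ 2;
          (2 * Real.eulerMascheroniConstant - 3) / 2,
          (3 - 2 * Real.pi ^ 2 - 3 * (3 - 2 * Real.eulerMascheroniConstant) ^ 2) / (12 * α₀),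
          (3 - 2 * Real.eulerMascheroniConstant) / 2,
          (3 - 2 * Real.eulerMascheroniConstant) / 2] := by
  -- `2 π ^ 2 - 3` is turned into an atom so that it can be cleared as a nonzero denominator.
  obtain ⟨q, hq⟩ : ∃ q, 2 * Real.pi ^ 2 - 3 = q := ⟨_, rfl⟩
  have hne : q ≠ 0 := by nlinarith [Real.pi_gt_three]
  have hq' : 3 - 2 * Real.pi ^ 2 = -q := by linarith
  have hu : ((1 : ℝ) + 1) / 2 = 1 := by norm_num
  simp only [limitMatrix, alphaOne_one, psiDot_one, varpi_one, Upsilon_one, deriv_Upsilon_one, hu,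
    Real.one_rpow, Real.log_one, hq, hq']
  ext i j
  fin_cases i <;> fin_cases j <;> simp <;> field_simp <;> ring

end Moments

/-! ### The profile likelihood, its score, and the estimator as a root. -/

section Score

/-- The empirical moment `k⁻¹ ∑ᵢ (yᵢ/σ)^{-α} log(yᵢ/σ)^j`. -/
noncomputable def powMean {k : ℕ} (z : Fin k → ℝ × ℝ) (σ : ℝ) (j : ℕ) (α : ℝ) : ℝ :=
  empMean z σ (fun p => p.2 ^ (-α) * Real.log p.2 ^ j)

/-- The score `Ψ` of the profile log-likelihood. -/
noncomputable def score {k : ℕ} (z : Fin k → ℝ × ℝ) (σ α : ℝ) : ℝ :=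
  2 / α + 2 * (powMean z σ 1 α / powMean z σ 0 α) -
    empMean z σ (fun p => Real.log p.2) - empMean z σ (fun p => Real.log p.1)

/-- The profile log-likelihood per observation, up to an additive constant. -/
noncomputable def profileLogLik {k : ℕ} (z : Fin k → ℝ × ℝ) (α : ℝ) : ℝ :=
  2 * Real.log α - 2 * Real.log (powMean z 1 0 α) -
    (α + 1) * (empMean z 1 (fun p => Real.log p.2) + empMean z 1 (fun p => Real.log p.1))

variable {k : ℕ} {z : Fin k → ℝ × ℝ} {σ : ℝ}

theorem powMean_zero_pos (hk : 0 < k) (hz : ∀ i, 0 < (z i).2) (hσ : 0 < σ) (α : ℝ) :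
    0 < powMean z σ 0 α := by
  have : Nonempty (Fin k) := ⟨⟨0, hk⟩⟩
  have hk' : (0 : ℝ) < k := by exact_mod_cast hk
  refine mul_pos (by positivity) (Finset.sum_pos (fun i _ => ?_) Finset.univ_nonempty)
  have := hz i
  simp only [pow_zero, mul_one]
  positivity

theorem hasDerivAt_powMean (hz : ∀ i, 0 < (z i).2) (hσ : 0 < σ) (j : ℕ) (α : ℝ) :
    HasDerivAt (powMean z σ j) (-powMean z σ (j + 1) α) α := by
  have h : ∀ i ∈ Finset.univ, HasDerivAt
      (fun α => ((z i).2 / σ) ^ (-α) * Real.log ((z i).2 / σ) ^ j)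
      (-(((z i).2 / σ) ^ (-α) * Real.log ((z i).2 / σ) ^ (j + 1))) α := by
    intro i _
    have hc : 0 < (z i).2 / σ := div_pos (hz i) hσ
    exact (((hasDerivAt_neg α).const_rpow hc).mul_const _).congr_deriv (by ring)
  refine ((HasDerivAt.fun_sum h).const_mul (1 / (k : ℝ))).congr_deriv ?_
  simp [powMean, empMean]

theorem sq_powMean_le (hk : 0 < k) (hz : ∀ i, 0 < (z i).2) (hσ : 0 < σ) (α : ℝ) :
    powMean z σ 1 α ^ 2 ≤ powMean z σ 2 α * powMean z σ 0 α := by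
  have h := Finset.sum_sq_le_sum_mul_sum_of_sq_le_mul (Finset.univ : Finset (Fin k))
    (r := fun i => ((z i).2 / σ) ^ (-α) * Real.log ((z i).2 / σ) ^ 1)
    (f := fun i => ((z i).2 / σ) ^ (-α) * Real.log ((z i).2 / σ) ^ 2)
    (g := fun i => ((z i).2 / σ) ^ (-α) * Real.log ((z i).2 / σ) ^ 0)
    (fun i _ => by have := hz i; positivity) (fun i _ => by have := hz i; positivity)
    (fun i _ => le_of_eq (by ring))
  have hk' : (0 : ℝ) ≤ (1 / (k : ℝ)) ^ 2 := by positivity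
  have := mul_le_mul_of_nonneg_left h hk'
  simp only [powMean, empMean]
  linarith

theorem hasDerivAt_score (hk : 0 < k) (hz : ∀ i, 0 < (z i).2) (hσ : 0 < σ) {α : ℝ} (hα : 0 < α) :
    HasDerivAt (score z σ) (-2 / α ^ 2 - 2 * ((powMean z σ 2 α * powMean z σ 0 α -
      powMean z σ 1 α ^ 2) / powMean z σ 0 α ^ 2)) α := by
  have h1 := ((hasDerivAt_powMean hz hσ 1 α).div (hasDerivAt_powMean hz hσ 0 α)
    (powMean_zero_pos hk hz hσ α).ne').const_mul 2
  have h2 : HasDerivAt (fun α : ℝ => 2 / α) (-2 / α ^ 2) α := by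
    have := (hasDerivAt_inv hα.ne').const_mul (2 : ℝ)
    refine this.congr_deriv (by ring)
  have := ((h2.add h1).sub_const (empMean z σ (fun p => Real.log p.2))).sub_const
    (empMean z σ (fun p => Real.log p.1))
  exact this.congr_deriv (by ring)

theorem strictAntiOn_score (hk : 0 < k) (hz : ∀ i, 0 < (z i).2) (hσ : 0 < σ) :
    StrictAntiOn (score z σ) (Ioi 0) := by
  refine strictAntiOn_of_deriv_neg (convex_Ioi 0)
    (fun α hα => (hasDerivAt_score hk hz hσ hα).continuousAt.continuousWithinAt) fun α hα => ?_
  rw [interior_Ioi] at hα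
  rw [(hasDerivAt_score hk hz hσ hα).deriv]
  have h1 := sq_powMean_le hk hz hσ α
  have hα' : (0 : ℝ) < α := hα
  have h2 : -2 / α ^ 2 < 0 := div_neg_of_neg_of_pos (by norm_num) (by positivity)
  have h3 : 0 ≤ (powMean z σ 2 α * powMean z σ 0 α - powMean z σ 1 α ^ 2) /
    powMean z σ 0 α ^ 2 := div_nonneg (by linarith) (by positivity)
  linarith

theorem powMean_zero_scale (hz : ∀ i, 0 < (z i).2) (hσ : 0 < σ) (α : ℝ) :
    powMean z σ 0 α = σ ^ α * powMean z 1 0 α := by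
  have e : ∀ i, ((z i).2 / σ) ^ (-α) = σ ^ α * (z i).2 ^ (-α) := fun i => by
    rw [Real.div_rpow (hz i).le hσ.le, Real.rpow_neg hσ.le, div_inv_eq_mul, mul_comm]
  simp only [powMean, empMean, pow_zero, mul_one, div_one, e, ← Finset.mul_sum]
  ring

theorem powMean_one_scale (hz : ∀ i, 0 < (z i).2) (hσ : 0 < σ) (α : ℝ) :
    powMean z σ 1 α = σ ^ α * (powMean z 1 1 α - Real.log σ * powMean z 1 0 α) := by
  have e : ∀ i, ((z i).2 / σ) ^ (-α) * Real.log ((z i).2 / σ) =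
      σ ^ α * ((z i).2 ^ (-α) * Real.log (z i).2 - Real.log σ * (z i).2 ^ (-α)) := fun i => by
    rw [Real.div_rpow (hz i).le hσ.le, Real.rpow_neg hσ.le, div_inv_eq_mul,
      Real.log_div (hz i).ne' hσ.ne']
    ring
  simp only [powMean, empMean, pow_zero, pow_one, mul_one, div_one, e, ← Finset.mul_sum,
    Finset.sum_sub_distrib]
  ring

theorem empMean_log_scale (hk : 0 < k) {f : ℝ × ℝ → ℝ} (hz : ∀ i, 0 < f (z i)) (hσ : 0 < σ)
    (hf : ∀ i, f ((z i).1 / σ, (z i).2 / σ) = f (z i) / σ) :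
    empMean z σ (fun p => Real.log (f p)) =
      empMean z 1 (fun p => Real.log (f p)) - Real.log σ := by
  have e : ∀ i, Real.log (f ((z i).1 / σ, (z i).2 / σ)) = Real.log (f (z i)) - Real.log σ :=
    fun i => by rw [hf, Real.log_div (hz i).ne' hσ.ne']
  have hk' : (k : ℝ) ≠ 0 := by exact_mod_cast hk.ne'
  simp only [empMean, e, div_one, Finset.sum_sub_distrib, Finset.sum_const, Finset.card_univ,
    Fintype.card_fin, nsmul_eq_mul]
  field_simp

/-- The score is scale invariant. -/
theorem score_scale (hk : 0 < k) (hz : ∀ i, 0 < (z i).2 ∧ (z i).2 ≤ (z i).1) (hσ : 0 < σ)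
    (α : ℝ) : score z σ α = score z 1 α := by
  have h1 := empMean_log_scale (z := z) (f := Prod.fst) hk
    (fun i => (hz i).1.trans_le (hz i).2) hσ (fun i => rfl)
  have h2 := empMean_log_scale (z := z) (f := Prod.snd) hk (fun i => (hz i).1) hσ (fun i => rfl)
  have hp := (powMean_zero_pos hk (fun i => (hz i).1) one_pos α).ne'
  have hs := (Real.rpow_pos_of_pos hσ α).ne'
  rw [score, score, powMean_zero_scale (fun i => (hz i).1) hσ,
    powMean_one_scale (fun i => (hz i).1) hσ, h1, h2]
  field_simp
  ring

/-- The ratio of the two power means is a weighted average of the `log yᵢ` with weights `yᵢ ^ (-α)`.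
It lies between the minimum `w m` of the `log yᵢ` and `w m + k / α`, so the score is positive for
small `α` and negative for large `α` unless the gap `d` vanishes, which forces all pairs to
coincide. -/
theorem exists_score_eq_zero (hk : 0 < k) (hz : ∀ i, 0 < (z i).2 ∧ (z i).2 ≤ (z i).1)
    (hne : ¬ AllEqual z) : ∃ α, 0 < α ∧ score z 1 α = 0 := by
  have : Nonempty (Fin k) := ⟨⟨0, hk⟩⟩
  have hk' : (0 : ℝ) < k := by exact_mod_cast hk
  set w : Fin k → ℝ := fun i => Real.log (z i).2 with hw
  set u : Fin k → ℝ := fun i => Real.log (z i).1 with hu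
  obtain ⟨m, -, hm⟩ := Finset.exists_min_image Finset.univ w Finset.univ_nonempty
  have huw : ∀ i, w i ≤ u i := fun i => Real.log_le_log (hz i).1 (hz i).2
  -- The limit of the score as `α → ∞` is `-d`.
  set d := (1 / (k : ℝ)) * ∑ i, (u i + w i - 2 * w m) with hd
  have hnn : ∀ i ∈ Finset.univ, 0 ≤ u i + w i - 2 * w m := fun i hi => by
    linarith [huw i, hm i hi]
  have hd0 : 0 < d := by
    refine mul_pos (by positivity) (lt_of_le_of_ne (Finset.sum_nonneg hnn) fun h => hne ?_)
    have h0 := (Finset.sum_eq_zero_iff_of_nonneg hnn).1 h.symm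
    have key : ∀ i, z i = (Real.exp (w m), Real.exp (w m)) := by
      intro i
      have a := h0 i (Finset.mem_univ i)
      have b := huw i
      have c := hm i (Finset.mem_univ i)
      refine Prod.ext ?_ ?_
      · change _ = Real.exp (w m)
        rw [show w m = u i by linarith, Real.exp_log ((hz i).1.trans_le (hz i).2)]
      · change _ = Real.exp (w m)
        rw [show w m = w i by linarith, Real.exp_log (hz i).1]
    intro i j
    rw [key i, key j]
  have hmean : empMean z 1 (fun p => Real.log p.2) + empMean z 1 (fun p => Real.log p.1) =
      d + 2 * w m := by
    simp only [empMean, div_one, hd, Finset.sum_sub_distrib, Finset.sum_add_distrib,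
      Finset.sum_const, Finset.card_univ, Fintype.card_fin, nsmul_eq_mul]
    field_simp
    ring
  have hpow : ∀ i α, (z i).2 ^ (-α) = Real.exp (-(α * w i)) := fun i α => by
    rw [Real.rpow_def_of_pos (hz i).1]; congr 1; ring
  have hdiff : ∀ α, powMean z 1 1 α - w m * powMean z 1 0 α =
      (1 / (k : ℝ)) * ∑ i, Real.exp (-(α * w i)) * (w i - w m) := fun α => by
    simp only [powMean, empMean, div_one, pow_one, pow_zero, mul_one, mul_sub, hpow,
      Finset.sum_sub_distrib, ← Finset.sum_mul]
    ring
  have hlow : ∀ α, w m ≤ powMean z 1 1 α / powMean z 1 0 α := fun α => by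
    rw [le_div_iff₀ (powMean_zero_pos hk (fun i => (hz i).1) one_pos α), ← sub_nonneg, hdiff]
    exact mul_nonneg (by positivity) (Finset.sum_nonneg fun i hi =>
      mul_nonneg (Real.exp_pos _).le (by linarith [hm i hi]))
  have hup : ∀ α, 0 < α → powMean z 1 1 α / powMean z 1 0 α ≤ w m + k / α := fun α hα => by
    rw [div_le_iff₀ (powMean_zero_pos hk (fun i => (hz i).1) one_pos α), add_mul,
      ← sub_le_iff_le_add', hdiff]
    -- With `t = α (w i - w m)` this is `t ≤ exp t`.
    have h1 : ∀ i ∈ Finset.univ, Real.exp (-(α * w i)) * (w i - w m) ≤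
        Real.exp (-(α * w m)) / α := fun i _ => by
      have := Real.add_one_le_exp (α * (w i - w m))
      have e : Real.exp (-(α * w m)) = Real.exp (-(α * w i)) * Real.exp (α * (w i - w m)) := by
        rw [← Real.exp_add]; congr 1; ring
      rw [le_div_iff₀ hα, e, mul_assoc]
      exact mul_le_mul_of_nonneg_left (by linarith) (Real.exp_pos _).le
    have h2 := Finset.sum_le_sum h1
    have h3 : (1 / (k : ℝ)) * Real.exp (-(α * w m)) ≤ powMean z 1 0 α := by
      simp only [powMean, empMean, div_one, pow_zero, mul_one, hpow]
      exact mul_le_mul_of_nonneg_left (Finset.single_le_sum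
        (f := fun i => Real.exp (-(α * w i))) (fun i _ => (Real.exp_pos _).le)
        (Finset.mem_univ m)) (by positivity)
    simp only [Finset.sum_const, Finset.card_univ, Fintype.card_fin, nsmul_eq_mul] at h2
    calc _ ≤ (1 / (k : ℝ)) * (k * (Real.exp (-(α * w m)) / α)) :=
          mul_le_mul_of_nonneg_left h2 (by positivity)
      _ = k / α * ((1 / (k : ℝ)) * Real.exp (-(α * w m))) := by field_simp
      _ ≤ _ := mul_le_mul_of_nonneg_left h3 (by positivity)
  -- With these endpoints the bounds above show that the score is at least `d` on the left and at
  -- most `-d / 2` on the right.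
  have hα1 : 0 < 1 / d := by positivity
  have hα2 : 0 < (4 + 4 * k) / d := by positivity
  have s1 : 0 ≤ score z 1 (1 / d) := by
    have := hlow (1 / d)
    rw [score, sub_sub, hmean]
    have : 2 / (1 / d) = 2 * d := by field_simp
    linarith
  have s2 : score z 1 ((4 + 4 * k) / d) ≤ 0 := by
    have h := hup _ hα2
    rw [score, sub_sub, hmean]
    have : 2 / ((4 + 4 * k) / d) + 2 * (k / ((4 + 4 * k) / d)) = d / 2 := by
      field_simp; ring
    linarith
  have hle : 1 / d ≤ (4 + 4 * k) / d := by gcongr; linarith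
  obtain ⟨a, ha, e⟩ := intermediate_value_Icc' hle (f := score z 1) (fun y hy =>
    (hasDerivAt_score hk (fun i => (hz i).1) one_pos
      (hα1.trans_le hy.1)).continuousAt.continuousWithinAt) ⟨s2, s1⟩
  exact ⟨a, hα1.trans_le ha.1, e⟩

theorem hasDerivAt_profileLogLik (hk : 0 < k) (hz : ∀ i, 0 < (z i).2) {α : ℝ} (hα : 0 < α) :
    HasDerivAt (profileLogLik z) (score z 1 α) α := by
  have h1 := (Real.hasDerivAt_log hα.ne').const_mul 2
  have h2 := ((hasDerivAt_powMean hz one_pos 0 α).log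
    (powMean_zero_pos hk hz one_pos α).ne').const_mul 2
  have h3 := ((hasDerivAt_id α).add_const 1).mul_const
    (empMean z 1 (fun p => Real.log p.2) + empMean z 1 (fun p => Real.log p.1))
  refine ((h1.sub h2).sub h3).congr_deriv ?_
  rw [score]
  ring

/-- The scale enters only through `T = s ^ α * powMean z 1 0 α / 2`, in the form `log T - T`, which
is maximal exactly at `T = 1`. This separates the optimization over `s` from that over `α`. -/
theorem logLik_eq (hk : 0 < k) (hz : ∀ i, 0 < (z i).2 ∧ (z i).2 ≤ (z i).1) {α s : ℝ}
    (hs : 0 < s) :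
    logLik z (α, s) = k * (profileLogLik z α + 2 * Real.log 2 +
      2 * (Real.log (s ^ α * powMean z 1 0 α / 2) - s ^ α * powMean z 1 0 α / 2)) := by
  have hk' : (k : ℝ) ≠ 0 := by exact_mod_cast hk.ne'
  have hp := powMean_zero_pos hk (fun i => (hz i).1) one_pos α
  have hs' := Real.rpow_pos_of_pos hs α
  have e : ∀ i, Real.log ((z i).1 * (z i).2) = Real.log (z i).1 + Real.log (z i).2 := fun i =>
    Real.log_mul ((hz i).1.trans_le (hz i).2).ne' (hz i).1.ne'
  have e1 : ∑ i, Real.log (z i).1 = k * empMean z 1 (fun p => Real.log p.1) := by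
    simp only [empMean, div_one]; field_simp
  have e2 : ∑ i, Real.log (z i).2 = k * empMean z 1 (fun p => Real.log p.2) := by
    simp only [empMean, div_one]; field_simp
  have e3 : ∑ i, (z i).2 ^ (-α) = k * powMean z 1 0 α := by
    simp only [powMean, empMean, div_one, pow_zero, mul_one]; field_simp
  rw [Real.log_div (by positivity) two_ne_zero, Real.log_mul hs'.ne' hp.ne', Real.log_rpow hs]
  simp only [logLik, profileLogLik, Finset.sum_add_distrib, ← Finset.mul_sum, e, e1, e2, e3]
  ring

theorem rpow_scale_mul_powMean (hk : 0 < k) (hz : ∀ i, 0 < (z i).2) {α s : ℝ} (hα : 0 < α)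
    (hs : 0 < s) : s ^ α * powMean z 1 0 α / 2 = 1 ↔ s = (powMean z 1 0 α / 2) ^ (-(1 / α)) := by
  have hp := powMean_zero_pos hk hz one_pos α
  have hs' := Real.rpow_pos_of_pos hs α
  have e : s ^ α * powMean z 1 0 α / 2 = 1 ↔ s ^ α = (powMean z 1 0 α / 2)⁻¹ := by
    rw [inv_div, eq_div_iff hp.ne', div_eq_iff two_ne_zero, one_mul]
  rw [e, Real.rpow_neg (by positivity), ← Real.inv_rpow (by positivity), one_div,
    Real.eq_rpow_inv hs.le (by positivity) hα.ne']

theorem log_sub_self_le {t : ℝ} (ht : 0 < t) : Real.log t - t ≤ -1 := by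
  linarith [Real.log_le_sub_one_of_pos ht]

theorem exists_isMLE (hk : 0 < k) (hz : ∀ i, 0 < (z i).2 ∧ (z i).2 ≤ (z i).1)
    (hne : ¬ AllEqual z) : ∃ θ, IsMLE z θ := by
  obtain ⟨a, ha, e⟩ := exists_score_eq_zero hk hz hne
  have hz' : ∀ i, 0 < (z i).2 := fun i => (hz i).1
  have hp := powMean_zero_pos hk hz' one_pos a
  have hanti := strictAntiOn_score hk hz' one_pos
  set s := (powMean z 1 0 a / 2) ^ (-(1 / a)) with hs
  have hs0 : 0 < s := by positivity
  have h1 := (rpow_scale_mul_powMean hk hz' ha hs0).2 hs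
  -- The decreasing score is the derivative of the profile likelihood, so the latter increases up to
  -- its zero `a` and decreases afterwards.
  have hmax : ∀ α, 0 < α → profileLogLik z α ≤ profileLogLik z a := by
    intro α hα
    have hc : ∀ β, 0 < β → ContinuousAt (profileLogLik z) β := fun β hβ =>
      (hasDerivAt_profileLogLik hk hz' hβ).continuousAt
    rcases le_total α a with h | h
    · have : MonotoneOn (profileLogLik z) (Icc α a) := by
        refine monotoneOn_of_deriv_nonneg (convex_Icc _ _)
          (fun β hβ => (hc β (hα.trans_le hβ.1)).continuousWithinAt) ?_ ?_ <;>
        · rw [interior_Icc]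
          intro β hβ
          have hβ0 := hα.trans hβ.1
          have hd := hasDerivAt_profileLogLik hk hz' hβ0
          first
          | exact hd.differentiableAt.differentiableWithinAt
          | (rw [hd.deriv, ← e]; exact hanti.antitoneOn hβ0 ha hβ.2.le)
      exact this ⟨le_rfl, h⟩ ⟨h, le_rfl⟩ h
    · have : AntitoneOn (profileLogLik z) (Icc a α) := by
        refine antitoneOn_of_deriv_nonpos (convex_Icc _ _)
          (fun β hβ => (hc β (ha.trans_le hβ.1)).continuousWithinAt) ?_ ?_ <;>
        · rw [interior_Icc]
          intro β hβ
          have hβ0 := ha.trans hβ.1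
          have hd := hasDerivAt_profileLogLik hk hz' hβ0
          first
          | exact hd.differentiableAt.differentiableWithinAt
          | (rw [hd.deriv, ← e]; exact hanti.antitoneOn ha hβ0 hβ.1.le)
      exact this ⟨le_rfl, h⟩ ⟨h, le_rfl⟩ h
  refine ⟨(a, s), ⟨ha, hs0⟩, ?_⟩
  rintro ⟨α, t⟩ ⟨hα : 0 < α, ht : 0 < t⟩
  change logLik z (α, t) ≤ logLik z (a, s)
  rw [logLik_eq hk hz ht, logLik_eq hk hz hs0, h1]
  have hpα := powMean_zero_pos hk hz' one_pos α
  have := log_sub_self_le (t := t ^ α * powMean z 1 0 α / 2) (by positivity)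
  have := hmax α hα
  rw [Real.log_one]
  refine mul_le_mul_of_nonneg_left ?_ k.cast_nonneg
  linarith

theorem IsMLE.score_eq_zero_and_scale_eq (hk : 0 < k)
    (hz : ∀ i, 0 < (z i).2 ∧ (z i).2 ≤ (z i).1) {θ : ℝ × ℝ} (h : IsMLE z θ) :
    score z 1 θ.1 = 0 ∧ θ.2 = (powMean z 1 0 θ.1 / 2) ^ (-(1 / θ.1)) := by
  obtain ⟨α, s⟩ := θ
  obtain ⟨⟨hα : 0 < α, hs : 0 < s⟩, hmax⟩ := h
  have hz' : ∀ i, 0 < (z i).2 := fun i => (hz i).1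
  have hk' : (0 : ℝ) < k := by exact_mod_cast hk
  have hp := fun β => powMean_zero_pos hk hz' one_pos β
  -- The maximizer is compared with `(β, t)`, where `t` is the optimal scale for `β`. Letting `β`
  -- vary near `α` gives the score equation by Fermat's rule; `β = α` forces `T = 1`, as `log T - T
  -- < -1` otherwise.
  have key : ∀ β, 0 < β → profileLogLik z β - 1 ≤ profileLogLik z α +
      (Real.log (s ^ α * powMean z 1 0 α / 2) - s ^ α * powMean z 1 0 α / 2) * 2 + 1 := by
    intro β hβ
    set t := (powMean z 1 0 β / 2) ^ (-(1 / β)) with ht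
    have ht0 : 0 < t := by have := hp β; positivity
    have h1 := (rpow_scale_mul_powMean hk hz' hβ ht0).2 ht
    have h2 : logLik z (β, t) ≤ logLik z (α, s) := hmax (show (β, t) ∈ Ioi (0 : ℝ) ×ˢ Ioi (0 : ℝ) from ⟨hβ, ht0⟩)
    rw [logLik_eq hk hz ht0, logLik_eq hk hz hs, h1, Real.log_one] at h2
    have := le_of_mul_le_mul_left h2 hk'
    linarith
  have hT : 0 < s ^ α * powMean z 1 0 α / 2 := by have := hp α; positivity
  have hlog := log_sub_self_le hT
  constructor
  · have hloc : IsLocalMax (profileLogLik z) α := by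
      filter_upwards [Ioi_mem_nhds hα] with β hβ
      linarith [key β hβ]
    have := hloc.hasDerivAt_eq_zero (hasDerivAt_profileLogLik hk hz' hα)
    exact this
  · rw [← rpow_scale_mul_powMean hk hz' hα hs]
    by_contra hne
    have := Real.log_lt_sub_one_of_pos hT hne
    linarith [key α hα]

/-- The maximum likelihood estimator solves the score equation at every scale. -/
theorem shapeMLE_scaleMLE_spec (hk : 0 < k) (hz : ∀ i, 0 < (z i).2 ∧ (z i).2 ≤ (z i).1)
    (hne : ¬ AllEqual z) :
    0 < (shapeMLE z).toReal ∧ shapeMLE z = ((shapeMLE z).toReal : EReal) ∧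
      ∀ σ, 0 < σ → score z σ (shapeMLE z).toReal = 0 ∧
        scaleMLE z / σ = (powMean z σ 0 (shapeMLE z).toReal / 2) ^
          (-(1 / (shapeMLE z).toReal)) := by
  have h := Classical.epsilon_spec (exists_isMLE hk hz hne)
  have h1 : shapeMLE z = ((Classical.epsilon (IsMLE z)).1 : EReal) := by
    rw [shapeMLE, if_neg hne]
  have h2 : scaleMLE z = (Classical.epsilon (IsMLE z)).2 := by
    rw [scaleMLE, if_neg hne]
  have h3 : (shapeMLE z).toReal = (Classical.epsilon (IsMLE z)).1 := by
    rw [h1, EReal.toReal_coe]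
  have hpos : 0 < (Classical.epsilon (IsMLE z)).1 := h.1.1
  obtain ⟨hs, he⟩ := h.score_eq_zero_and_scale_eq hk hz
  rw [h2, h3]
  refine ⟨hpos, h1, fun σ hσ => ⟨by rw [score_scale hk hz hσ, hs], ?_⟩⟩
  have hp := powMean_zero_pos hk (fun i => (hz i).1) one_pos (Classical.epsilon (IsMLE z)).1
  have hσ' := Real.rpow_pos_of_pos hσ (Classical.epsilon (IsMLE z)).1
  rw [powMean_zero_scale (fun i => (hz i).1) hσ, mul_div_assoc,
    Real.mul_rpow hσ'.le (by positivity), ← he, ← Real.rpow_mul hσ.le,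
    show (Classical.epsilon (IsMLE z)).1 * -(1 / (Classical.epsilon (IsMLE z)).1) = -1 by
      field_simp, Real.rpow_neg_one]
  ring

/-- This makes the estimator measurable although it is defined by a choice: by monotonicity its
sublevel sets are described by the sign of the score at the fixed point `c`. Ties count as small
values because `EReal.toReal ⊤ = 0`. -/
theorem shapeMLE_toReal_lt_iff (hk : 0 < k) (hz : ∀ i, 0 < (z i).2 ∧ (z i).2 ≤ (z i).1) {c : ℝ} :
    (shapeMLE z).toReal < c ↔ 0 < c ∧ (AllEqual z ∨ score z 1 c < 0) := by
  by_cases h : AllEqual z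
  · simp [shapeMLE, h]
  obtain ⟨hpos, -, hs⟩ := shapeMLE_scaleMLE_spec hk hz h
  have h0 := (hs 1 one_pos).1
  simp only [h, false_or]
  refine ⟨fun hc => ⟨hpos.trans hc, ?_⟩, fun hc => ?_⟩
  · rw [← h0]
    exact strictAntiOn_score hk (fun i => (hz i).1) one_pos hpos (hpos.trans hc) hc
  · obtain ⟨hc0, hc⟩ := hc
    rw [← h0] at hc
    exact ((strictAntiOn_score hk (fun i => (hz i).1) one_pos).lt_iff_gt hc0 hpos).1 hc

/-! ### Measurability of the estimators. -/

section Measurability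

variable {Ω : Type*} [MeasurableSpace Ω] {Z : Ω → Fin k → ℝ × ℝ}

theorem measurable_empMean (hZ : Measurable Z) (σ : ℝ) {f : ℝ × ℝ → ℝ} (hf : Measurable f) :
    Measurable fun ω => empMean (Z ω) σ f := by
  unfold empMean
  refine (Finset.measurable_sum _ fun i _ => hf.comp ?_).const_mul _
  have : Measurable fun ω => Z ω i := (measurable_pi_apply i).comp hZ
  exact (this.fst.div_const σ).prodMk (this.snd.div_const σ)

theorem measurableSet_allEqual (hZ : Measurable Z) : MeasurableSet {ω | AllEqual (Z ω)} := by
  simp only [AllEqual, ofPred_forall]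
  exact MeasurableSet.iInter fun i => MeasurableSet.iInter fun j =>
    measurableSet_eq_fun ((measurable_pi_apply i).comp hZ) ((measurable_pi_apply j).comp hZ)

theorem measurable_shapeMLE_toReal (hk : 0 < k) (hZ : Measurable Z)
    (hpos : ∀ ω i, 0 < (Z ω i).2 ∧ (Z ω i).2 ≤ (Z ω i).1) :
    Measurable fun ω => (shapeMLE (Z ω)).toReal := by
  refine measurable_of_Iio fun c => ?_
  have hs : Measurable fun ω => score (Z ω) 1 c := by
    unfold score powMean
    have := fun f hf => measurable_empMean hZ 1 (f := f) hf
    exact (((this _ (by fun_prop)).div (this _ (by fun_prop))).const_mul 2 |>.const_add _ |>.sub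
      (this _ (by fun_prop))).sub (this _ (by fun_prop))
  have : (fun ω => (shapeMLE (Z ω)).toReal) ⁻¹' Iio c =
      {ω | 0 < c ∧ (AllEqual (Z ω) ∨ score (Z ω) 1 c < 0)} := by
    ext ω
    exact shapeMLE_toReal_lt_iff hk (hpos ω)
  rw [this]
  exact (MeasurableSet.const _).inter
    ((measurableSet_allEqual hZ).union (measurableSet_lt hs measurable_const))

theorem measurable_shapeMLE (hk : 0 < k) (hZ : Measurable Z)
    (hpos : ∀ ω i, 0 < (Z ω i).2 ∧ (Z ω i).2 ≤ (Z ω i).1) :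
    Measurable fun ω => shapeMLE (Z ω) := by
  classical
  have h : Measurable fun ω => if AllEqual (Z ω) then (⊤ : EReal)
      else ((shapeMLE (Z ω)).toReal : EReal) :=
    Measurable.ite (measurableSet_allEqual hZ) measurable_const
      (measurable_shapeMLE_toReal hk hZ hpos).coe_real_ereal
  convert h using 2 with ω
  split_ifs with hω
  · rw [shapeMLE, if_pos hω]
  · exact (shapeMLE_scaleMLE_spec hk (hpos ω) hω).2.1

theorem measurable_scaleMLE (hk : 0 < k) (hZ : Measurable Z)
    (hpos : ∀ ω i, 0 < (Z ω i).2 ∧ (Z ω i).2 ≤ (Z ω i).1) :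
    Measurable fun ω => scaleMLE (Z ω) := by
  classical
  have hZi : ∀ i, Measurable fun ω => Z ω i := fun i => (measurable_pi_apply i).comp hZ
  have ha := measurable_shapeMLE_toReal hk hZ hpos
  have hm : Measurable fun ω => powMean (Z ω) 1 0 (shapeMLE (Z ω)).toReal := by
    simp only [powMean, empMean, pow_zero, mul_one, div_one]
    exact (Finset.measurable_sum _ fun i _ => (hZi i).snd.pow ha.neg).const_mul _
  have h : Measurable fun ω => if AllEqual (Z ω) then (Z ω ⟨0, hk⟩).2 else
      (powMean (Z ω) 1 0 (shapeMLE (Z ω)).toReal / 2) ^ (-(1 / (shapeMLE (Z ω)).toReal)) :=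
    Measurable.ite (measurableSet_allEqual hZ) (hZi _).snd
      ((hm.div_const 2).pow (ha.const_div 1).neg)
  convert h using 2 with ω
  split_ifs with hω
  · rw [scaleMLE, if_pos hω, dif_pos hk]
  · have := ((shapeMLE_scaleMLE_spec hk (hpos ω) hω).2.2 1 one_pos).2
    rwa [div_one] at this

end Measurability

end Score

/-! ### Convergence in probability and in distribution on varying probability spaces. -/

section ProbFilter

variable {Ω : ℕ → Type*} [∀ n, MeasurableSpace (Ω n)]

/-- The filter of events with probability tending to one. Convergence in probability to a constant
is convergence along this filter. -/
def probFilter (P : ∀ n, Measure (Ω n)) : Filter (Σ n, Ω n) where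
  sets := {S | Tendsto (fun n => P n {ω | (⟨n, ω⟩ : Σ n, Ω n) ∉ S}) atTop (𝓝 0)}
  univ_sets := by simp
  sets_of_superset := by
    intro S T hS hST
    exact tendsto_of_tendsto_of_tendsto_of_le_of_le tendsto_const_nhds hS (fun _ => zero_le)
      fun n => measure_mono fun ω hω h => hω (hST h)
  inter_sets := by
    intro S T hS hT
    have := Tendsto.add hS hT
    rw [add_zero] at this
    refine tendsto_of_tendsto_of_tendsto_of_le_of_le tendsto_const_nhds this (fun _ => zero_le)
      fun n => (measure_mono fun ω hω => ?_).trans (measure_union_le _ _)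
    by_contra hc
    simp only [mem_union, mem_ofPred_eq, not_or, not_not] at hc
    exact hω ⟨hc.1, hc.2⟩

variable {P : ∀ n, Measure (Ω n)}

theorem eventually_probFilter {p : (Σ n, Ω n) → Prop} :
    (∀ᶠ x in probFilter P, p x) ↔ Tendsto (fun n => P n {ω | ¬ p ⟨n, ω⟩}) atTop (𝓝 0) :=
  Iff.rfl

variable [∀ n, IsProbabilityMeasure (P n)] {Ω' : Type*} [MeasurableSpace Ω'] {P' : Measure Ω'}
  [IsProbabilityMeasure P'] {E : Type*} [TopologicalSpace E] [MeasurableSpace E]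

theorem limsup_measure_mem_le [OpensMeasurableSpace E] [HasOuterApproxClosed E]
    {X : ∀ n, Ω n → E} {Z : Ω' → E}
    (h : TendstoInDistribution X atTop Z P P') {C : Set E} (hC : IsClosed C) :
    limsup (fun n => P n {ω | X n ω ∈ C}) atTop ≤ P' {ω | Z ω ∈ C} := by
  have := ProbabilityMeasure.limsup_measure_closed_le_of_tendsto h.tendsto hC
  simp only [ProbabilityMeasure.coe_mk] at this
  rw [Measure.map_apply_of_aemeasurable h.aemeasurable_limit hC.measurableSet] at this
  simp only [Measure.map_apply_of_aemeasurable (h.forall_aemeasurable _) hC.measurableSet] at this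
  exact this

/-- The portmanteau bound applied to the complement of an open neighbourhood of `c`, which a
constant limit never visits. -/
theorem tendsto_probFilter_of_tendstoInDistribution_const [OpensMeasurableSpace E]
    [HasOuterApproxClosed E] {X : ∀ n, Ω n → E} {c : E}
    (h : TendstoInDistribution X atTop (fun _ : Ω' => c) P P') :
    Tendsto (fun p : Σ n, Ω n => X p.1 p.2) (probFilter P) (𝓝 c) := by
  rw [tendsto_nhds]
  intro U hU hc
  change Tendsto _ _ _
  have h1 := limsup_measure_mem_le h hU.isClosed_compl
  simp only [mem_compl_iff, hc, not_true_eq_false] at h1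
  have h2 : limsup (fun n => P n {ω | ¬ X n ω ∈ U}) atTop ≤ 0 := by simpa using h1
  exact tendsto_of_le_liminf_of_limsup_le (zero_le) h2

/-- A remainder that is negligible relative to a weakly convergent sequence tends to zero in
probability. -/
theorem tendsto_zero_of_isLittleO_of_tendstoInDistribution {E : Type*} [NormedAddCommGroup E]
    [MeasurableSpace E] [BorelSpace E] {G : ∀ n, Ω n → E} {W : Ω' → E}
    (hG : TendstoInDistribution G atTop W P P') {R : (Σ n, Ω n) → ℝ}
    (hR : R =o[probFilter P] fun p => G p.1 p.2) :
    Tendsto R (probFilter P) (𝓝 0) := by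
  have hcl : ∀ K : ℝ, IsClosed {x : E | K ≤ ‖x‖} := fun K =>
    isClosed_le continuous_const continuous_norm
  have htail : Tendsto (fun K : ℕ => P' {ω | (K : ℝ) ≤ ‖W ω‖}) atTop (𝓝 0) := by
    have hmeas : ∀ K : ℕ, NullMeasurableSet {ω | (K : ℝ) ≤ ‖W ω‖} P' := fun K =>
      hG.aemeasurable_limit.nullMeasurableSet_preimage (hcl K).measurableSet
    have hinter : ⋂ K : ℕ, {ω | (K : ℝ) ≤ ‖W ω‖} = ∅ := by
      ext ω
      obtain ⟨N, hN⟩ := exists_nat_gt ‖W ω‖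
      simp only [mem_iInter, mem_ofPred_eq, mem_empty_iff_false, iff_false, not_forall, not_le]
      exact ⟨N, hN⟩
    have := tendsto_measure_iInter_atTop (μ := P') hmeas
      (fun a b hab ω (hω : (b : ℝ) ≤ ‖W ω‖) => (Nat.cast_le.2 hab).trans hω)
      ⟨0, measure_ne_top _ _⟩
    rwa [hinter, measure_empty] at this
  rw [Metric.tendsto_nhds]
  intro ε hε
  rw [eventually_probFilter, ENNReal.tendsto_nhds_zero]
  intro η hη
  have hη2 : 0 < η / 2 := ENNReal.half_pos hη.ne'
  -- Tightness: the limit puts little mass on `K ≤ ‖x‖`, and as this set is closed the same holds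
  -- eventually for `G n`. Where `‖G n‖ < K`, the bound `ε / (2 K) * ‖G n‖` on the remainder is at
  -- most `ε / 2`.
  obtain ⟨K, hK, hK0⟩ := ((htail.eventually_lt_const hη2).and (eventually_gt_atTop 0)).exists
  have hK0' : (0 : ℝ) < K := by exact_mod_cast hK0
  have h1 : ∀ᶠ n in atTop, P n {ω | (K : ℝ) ≤ ‖G n ω‖} < η / 2 :=
    eventually_lt_of_limsup_lt ((limsup_measure_mem_le hG (hcl K)).trans_lt hK)
  have h2 := eventually_probFilter.1 (hR.bound (c := ε / (2 * K)) (by positivity))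
  filter_upwards [h1, h2.eventually_lt_const hη2] with n hn1 hn2
  calc P n {ω | ¬ dist (R ⟨n, ω⟩) 0 < ε}
      ≤ P n ({ω | (K : ℝ) ≤ ‖G n ω‖} ∪ {ω | ¬ ‖R ⟨n, ω⟩‖ ≤ ε / (2 * K) * ‖G n ω‖}) := by
        refine measure_mono fun ω hω => ?_
        by_contra hc
        simp only [mem_union, mem_ofPred_eq, not_or, not_le, not_lt] at hc
        apply hω
        rw [dist_zero_right]
        calc _ ≤ ε / (2 * K) * ‖G n ω‖ := hc.2
          _ ≤ ε / (2 * K) * K := by gcongr; exact hc.1.le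
          _ = ε / 2 := by field_simp
          _ < ε := by linarith
    _ ≤ η / 2 + η / 2 := (measure_union_le _ _).trans (add_le_add hn1.le hn2.le)
    _ = η := ENNReal.add_halves η

/-- Changing the variables on events with probability tending to zero does not change the limit in
distribution. -/
theorem tendstoInDistribution_congr_probFilter [OpensMeasurableSpace E]
    {X Y : ∀ n, Ω n → E} {Z : Ω' → E} (h : TendstoInDistribution X atTop Z P P')
    (hY : ∀ n, AEMeasurable (Y n) (P n)) (hXY : ∀ᶠ p in probFilter P, X p.1 p.2 = Y p.1 p.2) :
    TendstoInDistribution Y atTop Z P P' := by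
  have h0 := ProbabilityMeasure.tendsto_iff_forall_integral_tendsto.1 h.tendsto
  refine ⟨hY, h.aemeasurable_limit,
    ProbabilityMeasure.tendsto_iff_forall_integral_tendsto.2 fun f => ?_⟩
  have hXY' := eventually_probFilter.1 hXY
  refine (h0 f).congr_dist ?_
  simp only [ProbabilityMeasure.coe_mk]
  -- For a bounded continuous `f` the two expectations differ by at most `2 ‖f‖` times the
  -- probability that the variables differ.
  have hb : Tendsto (fun n => 2 * ‖f‖ * (P n).real {ω | ¬ X n ω = Y n ω}) atTop (𝓝 0) := by
    have := ((ENNReal.tendsto_toReal ENNReal.zero_ne_top).comp hXY').const_mul (2 * ‖f‖)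
    simpa [Measure.real, Function.comp_def] using this
  refine squeeze_zero (fun _ => dist_nonneg) (fun n => ?_) hb
  have hfm : Measurable f := f.continuous.measurable
  rw [integral_map (h.forall_aemeasurable n) hfm.aestronglyMeasurable,
    integral_map (hY n) hfm.aestronglyMeasurable]
  have i1 : Integrable (fun ω => f (X n ω)) (P n) :=
    Integrable.of_bound (hfm.comp_aemeasurable (h.forall_aemeasurable n)).aestronglyMeasurable ‖f‖
      (Eventually.of_forall fun ω => f.norm_coe_le_norm _)
  have i2 : Integrable (fun ω => f (Y n ω)) (P n) :=
    Integrable.of_bound (hfm.comp_aemeasurable (hY n)).aestronglyMeasurable ‖f‖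
      (Eventually.of_forall fun ω => f.norm_coe_le_norm _)
  rw [dist_eq_norm, ← integral_sub i1 i2]
  -- The set where the variables differ need not be measurable, so it is replaced by a measurable
  -- hull of the same measure.
  set T := toMeasurable (P n) {ω | ¬ X n ω = Y n ω} with hT
  have hTm : MeasurableSet T := measurableSet_toMeasurable _ _
  calc ‖∫ ω, f (X n ω) - f (Y n ω) ∂P n‖
      ≤ ∫ ω, T.indicator (fun _ => 2 * ‖f‖) ω ∂P n := by
        refine norm_integral_le_of_norm_le ((integrable_const _).indicator hTm)
          (Eventually.of_forall fun ω => ?_)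
        by_cases hω : X n ω = Y n ω
        · simp only [hω, sub_self, norm_zero]
          exact indicator_nonneg (fun _ _ => by positivity) _
        · rw [indicator_of_mem (subset_toMeasurable _ _ hω)]
          calc _ ≤ ‖f (X n ω)‖ + ‖f (Y n ω)‖ := norm_sub_le _ _
            _ ≤ ‖f‖ + ‖f‖ := add_le_add (f.norm_coe_le_norm _) (f.norm_coe_le_norm _)
            _ = 2 * ‖f‖ := by ring
    _ = 2 * ‖f‖ * (P n).real {ω | ¬ X n ω = Y n ω} := by
        rw [integral_indicator_const _ hTm, smul_eq_mul, mul_comm, Measure.real, hT,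
          measure_toMeasurable, Measure.real]

/-- Slutsky's lemma for random variables on varying probability spaces. -/
theorem tendstoInDistribution_of_tendsto_sub {E : Type*} [NormedAddCommGroup E]
    [SecondCountableTopology E] [MeasurableSpace E] [BorelSpace E]
    {X Y : ∀ n, Ω n → E} {Z : Ω' → E} (h : TendstoInDistribution X atTop Z P P')
    (hY : ∀ n, AEMeasurable (Y n) (P n))
    (hXY : Tendsto (fun p : Σ n, Ω n => Y p.1 p.2 - X p.1 p.2) (probFilter P) (𝓝 0)) :
    TendstoInDistribution Y atTop Z P P' := by
  -- All variables are lifted to the product of the spaces `Ω n` through the coordinate projections.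
  -- This keeps each law, and each pair `(X n, Y n)` jointly, so Slutsky's lemma on one common space
  -- applies.
  have hmp := measurePreserving_eval_infinitePi P
  have key : ∀ n {V : Ω n → E}, AEMeasurable V (P n) →
      (Measure.infinitePi P).map (fun ω => V (ω n)) = (P n).map V := by
    intro n V hV
    have hV' : AEMeasurable V ((Measure.infinitePi P).map (Function.eval n)) := by
      rwa [(hmp n).map_eq]
    have := AEMeasurable.map_map_of_aemeasurable hV' (hmp n).measurable.aemeasurable
    rw [(hmp n).map_eq] at this
    exact this.symm
  have haem : ∀ n {V : Ω n → E}, AEMeasurable V (P n) →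
      AEMeasurable (fun ω : ∀ n, Ω n => V (ω n)) (Measure.infinitePi P) := fun n V hV =>
    hV.comp_quasiMeasurePreserving (hmp n).quasiMeasurePreserving
  have hX' : TendstoInDistribution (fun n (ω : ∀ n, Ω n) => X n (ω n)) atTop Z
      (fun _ => Measure.infinitePi P) P' := by
    refine ⟨fun n => haem n (h.forall_aemeasurable n), h.aemeasurable_limit, ?_⟩
    refine h.tendsto.congr fun n => ?_
    exact Subtype.ext (key n (h.forall_aemeasurable n)).symm
  have hY' := tendstoInDistribution_of_tendstoInMeasure_sub
    (fun n (ω : ∀ n, Ω n) => Y n (ω n)) Z hX' ?_ (fun n => haem n (hY n))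
  · refine ⟨hY, h.aemeasurable_limit, hY'.tendsto.congr fun n => ?_⟩
    exact Subtype.ext (key n (hY n))
  · rw [tendstoInMeasure_iff_norm]
    intro ε hε
    have h1 := eventually_probFilter.1 (Metric.tendsto_nhds.1 hXY ε hε)
    refine h1.congr fun n => ?_
    have hnull : NullMeasurableSet {ω | ε ≤ ‖Y n ω - X n ω‖} (P n) :=
      nullMeasurableSet_le aemeasurable_const ((hY n).sub (h.forall_aemeasurable n)).norm
    have := (hmp n).measure_preimage hnull
    simp only [dist_zero_right, not_lt]
    rw [← this]
    simp [preimage]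

end ProbFilter

/-! ### Divided differences of the empirical moments. -/

section Taylor

variable {k : ℕ} {z : Fin k → ℝ × ℝ} {σ : ℝ}

/-- Half of the margin `η` absorbs the power, by `t ^ j / j! ≤ exp t` with `t = η |w| / 2`; the
other half absorbs the shift from `x` to `c`. What remains is `exp (-w c + η |w|)`, which is one of
the two exponentials on the right. In this way third-order log-moments, about which nothing is
assumed, are bounded by moments of order zero. -/
theorem abs_pow_mul_exp_le (j : ℕ) {w c x η : ℝ} (hη : 0 < η) (hx : |x - c| ≤ η / 2) :
    |w| ^ j * Real.exp (w * -x) ≤ j.factorial * (2 / η) ^ j *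
      (Real.exp (w * -(c - η)) + Real.exp (w * -(c + η))) := by
  have h1 := Real.pow_div_factorial_le_exp (η / 2 * |w|) (by positivity) j
  have hf : (0 : ℝ) < j.factorial := by exact_mod_cast j.factorial_pos
  have h2 : |w| ^ j ≤ j.factorial * (2 / η) ^ j * Real.exp (η / 2 * |w|) := by
    rw [div_le_iff₀ hf] at h1
    calc |w| ^ j = (2 / η) ^ j * (η / 2 * |w|) ^ j := by
          rw [← mul_pow]; congr 1; field_simp
      _ ≤ (2 / η) ^ j * (Real.exp (η / 2 * |w|) * j.factorial) := by gcongr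
      _ = _ := by ring
  have h3 : w * -x + η / 2 * |w| ≤ w * -c + η * |w| := by
    have : w * (c - x) ≤ |w| * (η / 2) := by
      calc w * (c - x) ≤ |w * (c - x)| := le_abs_self _
        _ = |w| * |x - c| := by rw [abs_mul, abs_sub_comm]
        _ ≤ _ := by gcongr
    linarith
  have h4 : Real.exp (w * -c + η * |w|) ≤
      Real.exp (w * -(c - η)) + Real.exp (w * -(c + η)) := by
    rcases abs_cases w with ⟨h, -⟩ | ⟨h, -⟩
    · rw [h, show w * -c + η * w = w * -(c - η) by ring]
      linarith [Real.exp_pos (w * -(c + η))]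
    · rw [h, show w * -c + η * -w = w * -(c + η) by ring]
      linarith [Real.exp_pos (w * -(c - η))]
  calc |w| ^ j * Real.exp (w * -x)
      ≤ j.factorial * (2 / η) ^ j * Real.exp (η / 2 * |w|) * Real.exp (w * -x) := by gcongr
    _ = j.factorial * (2 / η) ^ j * Real.exp (w * -x + η / 2 * |w|) := by
        rw [Real.exp_add]; ring
    _ ≤ j.factorial * (2 / η) ^ j * Real.exp (w * -c + η * |w|) := by gcongr
    _ ≤ _ := by gcongr

/-- All empirical moments near `c` are controlled by those of order zero at `c ± η`. -/
theorem abs_powMean_le (hz : ∀ i, 0 < (z i).2) (hσ : 0 < σ) (j : ℕ) {c x η : ℝ} (hη : 0 < η)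
    (hx : |x - c| ≤ η / 2) :
    |powMean z σ j x| ≤ j.factorial * (2 / η) ^ j *
      (powMean z σ 0 (c - η) + powMean z σ 0 (c + η)) := by
  have e : ∀ i t, ((z i).2 / σ) ^ t = Real.exp (Real.log ((z i).2 / σ) * t) := fun i t =>
    Real.rpow_def_of_pos (div_pos (hz i) hσ) t
  have h : ∀ i ∈ Finset.univ, |((z i).2 / σ) ^ (-x) * Real.log ((z i).2 / σ) ^ j| ≤
      j.factorial * (2 / η) ^ j * (((z i).2 / σ) ^ (-(c - η)) + ((z i).2 / σ) ^ (-(c + η))) := by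
    intro i _
    rw [e, e, e, abs_mul, abs_pow, abs_of_pos (Real.exp_pos _), mul_comm]
    exact abs_pow_mul_exp_le j hη hx
  simp only [powMean, empMean, pow_zero, mul_one]
  rw [abs_mul, abs_of_nonneg (by positivity : (0 : ℝ) ≤ 1 / k), ← mul_add, mul_left_comm,
    ← Finset.sum_add_distrib, Finset.mul_sum]
  exact mul_le_mul_of_nonneg_left ((Finset.abs_sum_le_sum_abs _ _).trans (Finset.sum_le_sum h))
    (by positivity)

/-- The mean value inequality twice: first `f'` varies by at most `K |t - c|`, then `f t - f' c * t`
varies by at most `K |x - c| ^ 2`, and division by `|x - c|` follows. -/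
theorem abs_dslope_sub_le {f f' f'' : ℝ → ℝ} {c x K : ℝ}
    (hf : ∀ t, HasDerivAt f (f' t) t) (hf' : ∀ t, HasDerivAt f' (f'' t) t)
    (hK : ∀ t ∈ uIcc c x, |f'' t| ≤ K) : |dslope f c x - f' c| ≤ K * |x - c| := by
  have hc : c ∈ uIcc c x := left_mem_uIcc
  have hx : x ∈ uIcc c x := right_mem_uIcc
  have h1 : ∀ t ∈ uIcc c x, |f' t - f' c| ≤ K * |t - c| := fun t ht =>
    Convex.norm_image_sub_le_of_norm_hasDerivWithin_le (fun y _ => (hf' y).hasDerivWithinAt)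
      hK (convex_uIcc c x) hc ht
  have hK0 : 0 ≤ K := (abs_nonneg _).trans (hK c hc)
  have h2 := Convex.norm_image_sub_le_of_norm_hasDerivWithin_le
    (f := fun t => f t - f' c * t) (f' := fun t => f' t - f' c) (C := K * |x - c|)
    (fun t _ => (((hf t).sub ((hasDerivAt_id t).const_mul (f' c))).congr_deriv
      (by ring)).hasDerivWithinAt)
    (fun t ht => (h1 t ht).trans (by gcongr K * ?_; exact abs_sub_left_of_mem_uIcc ht))
    (convex_uIcc c x) hc hx
  by_cases hxc : x = c
  · subst hxc
    rw [dslope_same, (hf x).deriv]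
    simp
  · have hpos : 0 < |x - c| := abs_pos.2 (sub_ne_zero.2 hxc)
    refine le_of_mul_le_mul_right ?_ hpos
    rw [← abs_mul]
    have e := sub_smul_dslope f c x
    rw [smul_eq_mul] at e
    have e' : (dslope f c x - f' c) * (x - c) = f x - f' c * x - (f c - f' c * c) := by
      linear_combination e
    rw [e']
    exact h2

theorem abs_dslope_powMean_add_le (hz : ∀ i, 0 < (z i).2) (hσ : 0 < σ) (j : ℕ) {c x η : ℝ}
    (hη : 0 < η) (hx : |x - c| ≤ η / 2) :
    |dslope (powMean z σ j) c x + powMean z σ (j + 1) c| ≤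
      (j + 2).factorial * (2 / η) ^ (j + 2) *
        (powMean z σ 0 (c - η) + powMean z σ 0 (c + η)) * |x - c| := by
  have := abs_dslope_sub_le (c := c) (x := x) (fun t => hasDerivAt_powMean hz hσ j t)
    (fun t => (hasDerivAt_powMean hz hσ (j + 1) t).neg)
    (fun t ht => by
      rw [neg_neg]
      exact abs_powMean_le hz hσ (j + 2) hη ((abs_sub_left_of_mem_uIcc ht).trans hx))
  rwa [sub_neg_eq_add] at this

end Taylor

/-! ### Exact linearization of the estimating equations. -/

/-- The linearization of the solution of the score equation. -/
theorem exists_linearization {S : Type*} {F : Filter S} {a q p A B : S → ℝ} {e : S → Fin 4 → ℝ}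
    {r α₀ c₃ c₄ : ℝ} (hr : r ∈ Icc (0 : ℝ) 1) (hα : 0 < α₀)
    (ha : Tendsto a F (𝓝 (alphaOne r α₀)))
    (hA : Tendsto A F (𝓝 (-1 / α₀ * deriv (Upsilon r) (varpi r))))
    (hB : Tendsto B F (𝓝 ((-1 / α₀) ^ 2 * deriv (deriv (Upsilon r)) (varpi r))))
    (he : ∀ j, Tendsto (fun s => e s j) F (𝓝 0))
    (hp : ∀ s, p s = -1 / α₀ * deriv (Upsilon r) (varpi r) + e s 0 -
      B s * (a s - alphaOne r α₀))
    (hq : ∀ s, q s = Upsilon r (varpi r) + e s 1 - A s * (a s - alphaOne r α₀))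
    (h0 : 2 / alphaOne r α₀ + 2 * (-1 / α₀ * deriv (Upsilon r) (varpi r) /
      Upsilon r (varpi r)) - c₃ - c₄ = 0)
    (hs : ∀ᶠ s in F, 2 / a s + 2 * (p s / q s) - (c₃ + e s 2) - (c₄ + e s 3) = 0) :
    ∃ c d : Fin 4 → S → ℝ,
      (∀ j, Tendsto (c j) F (𝓝 (limitMatrix r α₀ 0 j))) ∧
      (∀ j, Tendsto (d j) F (𝓝 (limitMatrix r α₀ 1 j))) ∧
      (∀ᶠ s in F, a s - alphaOne r α₀ = ∑ j, c j s * e s j) ∧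
      (∀ᶠ s in F, (q s / 2) ^ (-(1 / a s)) - sOne r α₀ = ∑ j, d j s * e s j) := by
  have hα1 : 0 < alphaOne r α₀ := alphaOne_pos hr hα
  have hU0 := Upsilon_pos hr (show -1 < varpi r by linarith [varpi_pos hr])
  have hD0 := psiDot_neg hr hα
  set α₁ := alphaOne r α₀ with hα₁
  set u := Upsilon r (varpi r) with hu
  set u' := deriv (Upsilon r) (varpi r) with hu'
  set u'' := deriv (deriv (Upsilon r)) (varpi r) with hu''
  have hDdef : psiDot r α₀ = -2 / α₁ ^ 2 - 2 * (u'' * u - u' ^ 2) / (α₀ ^ 2 * u ^ 2) := rfl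
  set D := psiDot r α₀ with hD
  set m := -1 / α₀ * u' with hm
  have hqt : Tendsto q F (𝓝 u) := by
    have : Tendsto (fun s => u + e s 1 - A s * (a s - α₁)) F (𝓝 (u + 0 - m * (α₁ - α₁))) :=
      ((he 1).const_add u).sub (hA.mul (ha.sub_const α₁))
    simp only [sub_self, mul_zero, add_zero, sub_zero] at this
    exact this.congr fun s => (hq s).symm
  have hE : Tendsto (fun s => 2 / (a s * α₁) + 2 * (u * B s - m * A s) / (q s * u)) F
      (𝓝 (-D)) := by
    have : Tendsto (fun s => 2 / (a s * α₁) + 2 * (u * B s - m * A s) / (q s * u)) F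
        (𝓝 (2 / (α₁ * α₁) + 2 * (u * ((-1 / α₀) ^ 2 * u'') - m * m) / (u * u))) :=
      ((tendsto_const_nhds (x := (2 : ℝ))).div (ha.mul_const α₁) (by positivity)).add
        ((((hB.const_mul u).sub (hA.const_mul m)).const_mul 2).div (hqt.mul_const u)
          (by positivity))
    convert this using 2
    rw [hDdef, hm]
    field_simp
    ring
  have hDne : -D ≠ 0 := by linarith
  -- Subtracting `h0` from the score equation and inserting `hp`, `hq` leaves `E` as the coefficient
  -- of `a - α₁`; it is minus the slope of the score, whence the limit `-D`.
  set E : S → ℝ := fun s => 2 / (a s * α₁) + 2 * (u * B s - m * A s) / (q s * u) with hEdef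
  set c : Fin 4 → S → ℝ := ![fun s => 2 / q s / E s, fun s => -(2 * m / (q s * u)) / E s,
    fun s => -1 / E s, fun s => -1 / E s] with hc
  have hct : ∀ j, Tendsto (c j) F (𝓝 (limitMatrix r α₀ 0 j)) := by
    have t0 : Tendsto (fun s => 2 / q s / E s) F (𝓝 (2 / u / -D)) :=
      ((tendsto_const_nhds (x := (2 : ℝ))).div hqt hU0.ne').div hE hDne
    have t1 : Tendsto (fun s => -(2 * m / (q s * u)) / E s) F (𝓝 (-(2 * m / (u * u)) / -D)) :=
      ((tendsto_const_nhds (x := 2 * m)).div (hqt.mul_const u) (by positivity)).neg.div hE hDne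
    have t2 : Tendsto (fun s => -1 / E s) F (𝓝 (-1 / -D)) :=
      (tendsto_const_nhds (x := (-1 : ℝ))).div hE hDne
    intro j
    fin_cases j
    · change Tendsto (fun s => 2 / q s / E s) F (𝓝 (-(2 / u) / D))
      convert t0 using 2
      rw [div_neg, neg_div]
    · change Tendsto (fun s => -(2 * m / (q s * u)) / E s) F
        (𝓝 (-(2 * u' / (α₀ * u ^ 2)) / D))
      convert t1 using 2
      rw [hm]
      field_simp
    · change Tendsto (fun s => -1 / E s) F (𝓝 (1 / D))
      convert t2 using 2
      rw [neg_div_neg_eq]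
    · change Tendsto (fun s => -1 / E s) F (𝓝 (1 / D))
      convert t2 using 2
      rw [neg_div_neg_eq]
  have hce : ∀ᶠ s in F, a s - α₁ = ∑ j, c j s * e s j := by
    filter_upwards [hs, ha.eventually_ne hα1.ne', hqt.eventually_ne hU0.ne', hE.eventually_ne hDne]
      with s hs1 has hqs hEs
    have key : (a s - α₁) * E s = 2 / q s * e s 0 - 2 * m / (q s * u) * e s 1 - e s 2 - e s 3 := by
      have h1 : 2 / a s = 2 / α₁ - 2 * (a s - α₁) / (a s * α₁) := by field_simp; ring
      have h2 : p s / q s = m / u + (u * (p s - m) - m * (q s - u)) / (q s * u) := by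
        field_simp; ring
      have h3 : (u * (p s - m) - m * (q s - u)) / (q s * u) =
          1 / q s * e s 0 - m / (q s * u) * e s 1 -
            (u * B s - m * A s) / (q s * u) * (a s - α₁) := by
        rw [hp s, hq s] at *
        field_simp
        ring
      rw [hEdef]
      rw [h1, h2, h3] at hs1
      linear_combination -hs1 + h0
    have : ∑ j, c j s * e s j =
        (2 / q s * e s 0 - 2 * m / (q s * u) * e s 1 - e s 2 - e s 3) / E s := by
      simp only [Fin.sum_univ_four]
      change 2 / q s / E s * e s 0 + -(2 * m / (q s * u)) / E s * e s 1 + -1 / E s * e s 2 +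
        -1 / E s * e s 3 = _
      ring
    rw [this, ← key, mul_div_cancel_right₀ _ hEs]
  -- The scale estimate is `exp X` with `X = -log (q / 2) / a`. Divided differences of `log` and
  -- `exp` give an exact form of the delta method.
  set L : ℝ → ℝ := fun x => Real.log (x / 2) with hL
  have hLd : HasDerivAt L (1 / u) u := by
    have := ((hasDerivAt_id u).div_const 2).log (by simpa using hU0.ne')
    refine this.congr_deriv ?_
    simp only [id]
    field_simp
  set X₀ := L u * -(1 / α₁) with hX₀
  set X : S → ℝ := fun s => L (q s) * -(1 / a s) with hX
  have hLt : Tendsto (fun s => dslope L u (q s)) F (𝓝 (1 / u)) := by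
    have := (continuousAt_dslope_same.2 hLd.differentiableAt).tendsto.comp hqt
    rwa [dslope_same, hLd.deriv] at this
  have hXt : Tendsto X F (𝓝 X₀) :=
    (hLd.continuousAt.tendsto.comp hqt).mul
      ((tendsto_const_nhds (x := (1 : ℝ))).div ha hα1.ne').neg
  have hXe : Tendsto (fun s => dslope Real.exp X₀ (X s)) F (𝓝 (Real.exp X₀)) := by
    have := (continuousAt_dslope_same.2 (Real.hasDerivAt_exp X₀).differentiableAt).tendsto.comp hXt
    rwa [dslope_same, (Real.hasDerivAt_exp X₀).deriv] at this
  -- The coefficient of `a - α₁` in `X - X₀`: the first term comes from the dependence of `q` on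
  -- `a`, the second from the exponent `1 / a`.
  set H : S → ℝ := fun s => 1 / a s * dslope L u (q s) * A s + L u / (a s * α₁) with hH
  have hHt : Tendsto H F (𝓝 (1 / α₁ * (1 / u) * m + L u / (α₁ * α₁))) :=
    ((((tendsto_const_nhds (x := (1 : ℝ))).div ha hα1.ne').mul hLt).mul hA).add
      ((tendsto_const_nhds (x := L u)).div (ha.mul_const α₁) (by positivity))
  -- The extra term at `j = 1` (the function `f₂ = y ^ (-α₁)`) is the direct effect of the error `e
  -- 1` on `q`, apart from its effect through `a`.
  set d : Fin 4 → S → ℝ := fun j s => dslope Real.exp X₀ (X s) *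
    (H s * c j s - if j = 1 then 1 / a s * dslope L u (q s) else 0) with hd
  have hsOne : sOne r α₀ = Real.exp X₀ := by
    rw [sOne, ← hu, ← hα₁, hX₀, hL, ← Real.rpow_def_of_pos (by positivity),
      Real.rpow_neg (by positivity), ← Real.inv_rpow (by positivity), inv_div]
  have hexp : (u / 2) ^ (-(1 / α₁)) = Real.exp X₀ := by
    rw [hX₀, hL, ← Real.rpow_def_of_pos (by positivity)]
  refine ⟨c, d, hct, fun j => ?_, hce, ?_⟩
  · have t : Tendsto (d j) F (𝓝 (Real.exp X₀ * ((1 / α₁ * (1 / u) * m + L u / (α₁ * α₁)) *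
        limitMatrix r α₀ 0 j - if j = 1 then 1 / α₁ * (1 / u) else 0))) := by
      refine hXe.mul ((hHt.mul (hct j)).sub ?_)
      split_ifs
      · exact ((tendsto_const_nhds (x := (1 : ℝ))).div ha hα1.ne').mul hLt
      · exact tendsto_const_nhds
    convert t using 2
    have hexp1 : (u / 2) ^ (-(1 / α₁) - 1) = Real.exp X₀ / (u / 2) := by
      rw [Real.rpow_sub_one (by positivity), hexp]
    have hDne' : D ≠ 0 := hD0.ne
    fin_cases j
    · change (u / 2) ^ (-(1 / α₁)) / (α₁ * D) *
        (u' / (2 * α₀ * (u / 2) ^ 2) - L u / (α₁ * (u / 2))) =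
        Real.exp X₀ * ((1 / α₁ * (1 / u) * m + L u / (α₁ * α₁)) * (-(2 / u) / D) - 0)
      rw [hexp, hm]
      field_simp
      ring
    · change (u / 2) ^ (-(1 / α₁)) / (α₁ * D) * (u' ^ 2 / (4 * α₀ ^ 2 * (u / 2) ^ 3) -
        u' * L u / (2 * α₀ * α₁ * (u / 2) ^ 2)) - (u / 2) ^ (-(1 / α₁) - 1) / (2 * α₁) =
        Real.exp X₀ * ((1 / α₁ * (1 / u) * m + L u / (α₁ * α₁)) *
          (-(2 * u' / (α₀ * u ^ 2)) / D) - 1 / α₁ * (1 / u))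
      rw [hexp, hexp1, hm]
      field_simp
      ring
    · change (u / 2) ^ (-(1 / α₁)) / (α₁ * D) * (L u / α₁ - u' / (2 * α₀ * (u / 2))) =
        Real.exp X₀ * ((1 / α₁ * (1 / u) * m + L u / (α₁ * α₁)) * (1 / D) - 0)
      rw [hexp, hm]
      field_simp
      ring
    · change (u / 2) ^ (-(1 / α₁)) / (α₁ * D) * (L u / α₁ - u' / (2 * α₀ * (u / 2))) =
        Real.exp X₀ * ((1 / α₁ * (1 / u) * m + L u / (α₁ * α₁)) * (1 / D) - 0)
      rw [hexp, hm]
      field_simp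
      ring
  · filter_upwards [hce, ha.eventually_ne hα1.ne', hqt.eventually (lt_mem_nhds hU0)]
      with s hcs has hqs
    have hsum : ∑ j, d j s * e s j = dslope Real.exp X₀ (X s) *
        (H s * (a s - α₁) - 1 / a s * dslope L u (q s) * e s 1) := by
      rw [hcs]
      simp only [Fin.sum_univ_four, hd]
      simp
      ring
    have e1 : (q s / 2) ^ (-(1 / a s)) = Real.exp (X s) :=
      Real.rpow_def_of_pos (by positivity) _
    have e2 := sub_smul_dslope Real.exp X₀ (X s)
    have e3 := sub_smul_dslope L u (q s)
    rw [smul_eq_mul] at e2 e3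
    rw [hsum, e1, hsOne, ← e2, mul_comm]
    congr 1
    have e4 : L (q s) = L u + (q s - u) * dslope L u (q s) := by linarith
    have e5 : q s - u = e s 1 - A s * (a s - α₁) := by rw [hq s]; ring
    rw [e5] at e4
    simp only [hX, hX₀, hH]
    rw [e4]
    field_simp
    ring

/-! ### Consistency and asymptotic expansion of the estimator. -/

section Asymptotics

variable {Ω : ℕ → Type*} [∀ n, MeasurableSpace (Ω n)] {P : ∀ n, Measure (Ω n)}
  [∀ n, IsProbabilityMeasure (P n)] {Ω' : Type*} [MeasurableSpace Ω'] {P' : Measure Ω'}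
  [IsProbabilityMeasure P'] {k : ℕ → ℕ} {Z : ∀ n, Ω n → Fin (k n) → ℝ × ℝ} {ρ : ℝ → ℝ} {α₀ : ℝ}
  {σ : ℕ → ℝ} {αm αp : ℝ} {v : ℕ → ℝ} {W : Ω' → Fin 4 → ℝ}

theorem IsWelschFunction.map_zero_mem_Icc (h : IsWelschFunction ρ) : ρ 0 ∈ Icc (0 : ℝ) 1 :=
  h.mapsTo (by simp)

theorem rpow_mul_log_pow_mem_classF2 {j : ℕ} (hj : j ≤ 2) {α : ℝ}
    (hα : α ∈ Ioo αm αp) : (fun z : ℝ × ℝ => z.2 ^ (-α) * Real.log z.2 ^ j) ∈ classF2 αm αp := by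
  interval_cases j
  · exact Or.inl (Or.inl (Or.inr ⟨α, hα, by simp⟩))
  · exact Or.inl (Or.inr ⟨α, hα, by simp⟩)
  · exact Or.inr ⟨α, hα, rfl⟩

theorem AsymptoticCondition.tendsto_powMean
    (hcond : AsymptoticCondition P P' Z ρ α₀ σ αm αp v W) {j : ℕ} (hj : j ≤ 2) {α : ℝ}
    (hα : α ∈ Ioo αm αp) :
    Tendsto (fun p : Σ n, Ω n => powMean (Z p.1 p.2) (σ p.1) j α) (probFilter P)
      (𝓝 ((-1 / α₀) ^ j * iteratedDeriv j (Upsilon (ρ 0)) (α / α₀))) := by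
  have h := tendsto_probFilter_of_tendstoInDistribution_const
    (hcond.lln _ (rpow_mul_log_pow_mem_classF2 hj hα))
  rw [limitMean_rpow_mul_log_pow hcond.welsch hcond.alpha_pos (hcond.lower_pos.trans hα.1).le] at h
  exact h

/-- The limiting means of `log y` and `log x` are `(γ - ρ₀) / α₀` and `γ / α₀`; they produce the
constant `ρ₀ / 2 - γ` in `Π`, which makes `ϖ α₀` the zero of the limiting score. -/
theorem limitMean_log_add (hρ : IsWelschFunction ρ) (hα : 0 < α₀) {α : ℝ} (h0 : 0 < α) :
    2 / α + 2 * (-1 / α₀ * deriv (Upsilon (ρ 0)) (α / α₀) / Upsilon (ρ 0) (α / α₀)) -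
      limitMean ρ α₀ (fun p => Real.log p.2) - limitMean ρ α₀ (fun p => Real.log p.1) =
      2 / α₀ * PiFun (ρ 0) (α / α₀) := by
  have hU := (Upsilon_pos hρ.map_zero_mem_Icc
    (show -1 < α / α₀ by linarith [div_pos h0 hα])).ne'
  rw [limitMean_log_fst hρ hα, limitMean_log_snd hρ hα, deriv_Upsilon_zero, deriv_Upsilon_zero,
    PiFun]
  field_simp
  ring

theorem AsymptoticCondition.tendsto_score
    (hcond : AsymptoticCondition P P' Z ρ α₀ σ αm αp v W) {α : ℝ} (hα : α ∈ Ioo αm αp) :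
    Tendsto (fun p : Σ n, Ω n => score (Z p.1 p.2) (σ p.1) α) (probFilter P)
      (𝓝 (2 / α₀ * PiFun (ρ 0) (α / α₀))) := by
  have h0 : 0 < α := hcond.lower_pos.trans hα.1
  have hU := (Upsilon_pos hcond.welsch.map_zero_mem_Icc
    (show -1 < α / α₀ by linarith [div_pos h0 hcond.alpha_pos])).ne'
  have t0 := hcond.tendsto_powMean (j := 0) (by norm_num) hα
  have t1 := hcond.tendsto_powMean (j := 1) (by norm_num) hα
  have t2 := tendsto_probFilter_of_tendstoInDistribution_const (hcond.lln (fun p => Real.log p.2)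
    (Or.inl (Or.inl (Or.inl (Or.inr rfl)))))
  have t3 := tendsto_probFilter_of_tendstoInDistribution_const (hcond.lln (fun p => Real.log p.1)
    (Or.inl (Or.inl (Or.inl (Or.inl rfl)))))
  simp only [pow_zero, one_mul, pow_one, iteratedDeriv_zero, iteratedDeriv_one] at t0 t1
  rw [← limitMean_log_add hcond.welsch hcond.alpha_pos h0]
  exact ((((t1.div t0 hU).const_mul 2).const_add _).sub t2).sub t3

/-- Consistency of the shape estimator. -/
theorem AsymptoticCondition.tendsto_shapeMLE
    (hcond : AsymptoticCondition P P' Z ρ α₀ σ αm αp v W) (hk : ∀ n, 0 < k n)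
    (hZpos : ∀ n ω i, 0 < (Z n ω i).2 ∧ (Z n ω i).2 ≤ (Z n ω i).1)
    (hties : ∀ᶠ p : Σ n, Ω n in probFilter P, ¬ AllEqual (Z p.1 p.2)) :
    Tendsto (fun p : Σ n, Ω n => (shapeMLE (Z p.1 p.2)).toReal) (probFilter P)
      (𝓝 (alphaOne (ρ 0) α₀)) := by
  have hr := hcond.welsch.map_zero_mem_Icc
  have hα := hcond.alpha_pos
  have hanti := strictAntiOn_PiFun hr
  have hv := varpi_pos hr
  -- At a fixed `c` the empirical score eventually has the sign of its limit, and since it decreases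
  -- this sign tells on which side of `c` its root lies.
  have hspec : ∀ {c : ℝ}, c ∈ Ioo αm αp → ∀ᶠ p : Σ n, Ω n in probFilter P,
      (c < alphaOne (ρ 0) α₀ → c < (shapeMLE (Z p.1 p.2)).toReal) ∧
      (alphaOne (ρ 0) α₀ < c → (shapeMLE (Z p.1 p.2)).toReal < c) := by
    intro c hc
    have hc0 : 0 < c := hcond.lower_pos.trans hc.1
    have ht := hcond.tendsto_score hc
    have e : PiFun (ρ 0) (varpi (ρ 0)) = 0 := PiFun_varpi hr
    rcases lt_trichotomy c (alphaOne (ρ 0) α₀) with h | h | h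
    · have h1 : 0 < PiFun (ρ 0) (c / α₀) := by
        refine e.symm.trans_lt ?_
        exact hanti (div_pos hc0 hα) hv ((div_lt_iff₀ hα).2 h)
      filter_upwards [ht.eventually (lt_mem_nhds (mul_pos (div_pos two_pos hα) h1)), hties]
        with p hp hne
      refine ⟨fun _ => ?_, fun h' => absurd h h'.asymm⟩
      obtain ⟨hpos, -, hs⟩ := shapeMLE_scaleMLE_spec (hk _) (hZpos p.1 p.2) hne
      rw [← (hs _ (hcond.sigma_pos p.1)).1] at hp
      exact ((strictAntiOn_score (hk _) (fun i => (hZpos p.1 p.2 i).1)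
        (hcond.sigma_pos p.1)).lt_iff_gt hpos hc0).1 hp
    · exact Eventually.of_forall fun p => ⟨fun h' => absurd h h'.ne, fun h' => absurd h h'.ne'⟩
    · have h1 : PiFun (ρ 0) (c / α₀) < 0 := by
        refine LT.lt.trans_eq ?_ e
        exact hanti hv (div_pos hc0 hα) ((lt_div_iff₀ hα).2 h)
      filter_upwards [ht.eventually (gt_mem_nhds (mul_neg_of_pos_of_neg (div_pos two_pos hα) h1)),
        hties] with p hp hne
      refine ⟨fun h' => absurd h h'.asymm, fun _ => ?_⟩
      obtain ⟨hpos, -, hs⟩ := shapeMLE_scaleMLE_spec (hk _) (hZpos p.1 p.2) hne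
      rw [← (hs _ (hcond.sigma_pos p.1)).1] at hp
      exact ((strictAntiOn_score (hk _) (fun i => (hZpos p.1 p.2 i).1)
        (hcond.sigma_pos p.1)).lt_iff_gt hc0 hpos).1 hp
  rw [tendsto_order]
  constructor
  · intro c hc
    -- `c` itself may lie outside `(αm, αp)`, where the law of large numbers is not available, so a
    -- closer point `b` is used.
    obtain ⟨b, hb1, hb2⟩ := exists_between (max_lt hc hcond.lower_lt)
    rw [max_lt_iff] at hb1
    filter_upwards [hspec ⟨hb1.2, hb2.trans hcond.lt_upper⟩] with p hp using hb1.1.trans (hp.1 hb2)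
  · intro c hc
    obtain ⟨b, hb1, hb2⟩ := exists_between (lt_min hc hcond.lt_upper)
    rw [lt_min_iff] at hb2
    filter_upwards [hspec ⟨hcond.lower_lt.trans hb1, hb2.2⟩] with p hp using (hp.2 hb1).trans hb2.1

/-- The divided differences of the empirical moments converge along the estimator. -/
theorem AsymptoticCondition.tendsto_dslope_powMean
    (hcond : AsymptoticCondition P P' Z ρ α₀ σ αm αp v W)
    (hZpos : ∀ n ω i, 0 < (Z n ω i).2) {a : (Σ n, Ω n) → ℝ}
    (ha : Tendsto a (probFilter P) (𝓝 (alphaOne (ρ 0) α₀))) {j : ℕ} (hj : j ≤ 1) :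
    Tendsto (fun p : Σ n, Ω n => -dslope (powMean (Z p.1 p.2) (σ p.1) j) (alphaOne (ρ 0) α₀) (a p))
      (probFilter P)
      (𝓝 ((-1 / α₀) ^ (j + 1) * iteratedDeriv (j + 1) (Upsilon (ρ 0)) (varpi (ρ 0)))) := by
  have hα := hcond.alpha_pos
  set α₁ := alphaOne (ρ 0) α₀ with hα₁
  have hdiv : α₁ / α₀ = varpi (ρ 0) := by rw [hα₁, alphaOne, mul_div_cancel_right₀ _ hα.ne']
  -- Chosen so that both `α₁ - η` and `α₁ + η` stay in `(αm, αp)`; the zero-order moments there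
  -- converge and keep the Lipschitz constant of the slope bounded in probability.
  obtain ⟨η, hη0, hη⟩ : ∃ η, 0 < η ∧ η < min (α₁ - αm) (αp - α₁) :=
    exists_between (lt_min (sub_pos.2 hcond.lower_lt) (sub_pos.2 hcond.lt_upper))
  rw [lt_min_iff] at hη
  have tm := hcond.tendsto_powMean (j := 0) (α := α₁ - η) (by norm_num)
    ⟨by linarith, by linarith [hcond.lt_upper]⟩
  have tp := hcond.tendsto_powMean (j := 0) (α := α₁ + η) (by norm_num)
    ⟨by linarith [hcond.lower_lt], by linarith⟩
  have tc := hcond.tendsto_powMean (j := j + 1) (α := α₁) (by linarith)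
    ⟨hcond.lower_lt, hcond.lt_upper⟩
  rw [hdiv] at tc
  have hh : Tendsto (fun p => |a p - α₁|) (probFilter P) (𝓝 0) := by
    simpa using (ha.sub_const α₁).abs
  have hb := (((tm.add tp).const_mul ((j + 2).factorial * (2 / η) ^ (j + 2) : ℝ)).mul hh)
  rw [mul_zero] at hb
  have hz : Tendsto (fun p : Σ n, Ω n => dslope (powMean (Z p.1 p.2) (σ p.1) j) α₁ (a p) +
      powMean (Z p.1 p.2) (σ p.1) (j + 1) α₁) (probFilter P) (𝓝 0) := by
    refine squeeze_zero_norm' ?_ hb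
    filter_upwards [hh.eventually (gt_mem_nhds (half_pos hη0))] with p hp
    exact abs_dslope_powMean_add_le (hZpos p.1 p.2) (hcond.sigma_pos p.1) j hη0 hp.le
  have := tc.sub hz
  rw [sub_zero] at this
  refine this.congr fun p => ?_
  ring

/-- A linear combination of the errors with coefficients converging to `β` equals, after scaling,
the linear combination of the empirical process up to a term vanishing in probability. -/
theorem AsymptoticCondition.tendsto_remainder
    (hcond : AsymptoticCondition P P' Z ρ α₀ σ αm αp v W) {D : (Σ n, Ω n) → ℝ}
    {c : Fin 4 → (Σ n, Ω n) → ℝ} {β : Fin 4 → ℝ}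
    (hc : ∀ j, Tendsto (c j) (probFilter P) (𝓝 (β j)))
    (hD : ∀ᶠ p : Σ n, Ω n in probFilter P, D p = ∑ j, c j p *
      (empMean (Z p.1 p.2) (σ p.1) (testFun (alphaOne (ρ 0) α₀) j) -
        limitMean ρ α₀ (testFun (alphaOne (ρ 0) α₀) j))) :
    Tendsto (fun p => v p.1 * D p - β ⬝ᵥ empProc (Z p.1 p.2) ρ α₀ (σ p.1) (v p.1))
      (probFilter P) (𝓝 0) := by
  refine tendsto_zero_of_isLittleO_of_tendstoInDistribution (E := Fin 4 → ℝ) hcond.weak_limit ?_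
  -- Coefficient errors tend to zero and multiply the empirical process, hence are negligible
  -- relative to its norm.
  have h : (fun p : Σ n, Ω n => ∑ j, (c j p - β j) * empProc (Z p.1 p.2) ρ α₀ (σ p.1) (v p.1) j)
      =o[probFilter P] fun p : Σ n, Ω n => empProc (Z p.1 p.2) ρ α₀ (σ p.1) (v p.1) := by
    refine Asymptotics.IsLittleO.fun_sum fun j _ => ?_
    have h1 : (fun p => c j p - β j) =o[probFilter P] fun _ => (1 : ℝ) := by
      rw [Asymptotics.isLittleO_one_iff]
      simpa using (hc j).sub_const (β j)
    have h2 : (fun p : Σ n, Ω n => empProc (Z p.1 p.2) ρ α₀ (σ p.1) (v p.1) j)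
        =O[probFilter P] fun p : Σ n, Ω n => ‖empProc (Z p.1 p.2) ρ α₀ (σ p.1) (v p.1)‖ :=
      Asymptotics.IsBigO.of_bound 1 (Eventually.of_forall fun p => by
        rw [norm_norm, one_mul]
        exact norm_le_pi_norm _ j)
    have := h1.mul_isBigO h2
    simp only [one_mul] at this
    exact this.of_norm_right
  refine h.congr' ?_ EventuallyEq.rfl
  filter_upwards [hD] with p hp
  rw [hp]
  simp only [dotProduct, empProc, Finset.mul_sum, ← Finset.sum_sub_distrib]
  exact Finset.sum_congr rfl fun j _ => by ring

/-- The asymptotic linearization of the maximum likelihood estimator. -/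
theorem AsymptoticCondition.tendsto_estimation_error
    (hcond : AsymptoticCondition P P' Z ρ α₀ σ αm αp v W) (hk : ∀ n, 0 < k n)
    (hZpos : ∀ n ω i, 0 < (Z n ω i).2 ∧ (Z n ω i).2 ≤ (Z n ω i).1)
    (hties : ∀ᶠ p : Σ n, Ω n in probFilter P, ¬ AllEqual (Z p.1 p.2)) :
    Tendsto (fun p : Σ n, Ω n => v p.1 * ((shapeMLE (Z p.1 p.2)).toReal - alphaOne (ρ 0) α₀) -
      (limitMatrix (ρ 0) α₀ *ᵥ empProc (Z p.1 p.2) ρ α₀ (σ p.1) (v p.1)) 0)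
      (probFilter P) (𝓝 0) ∧
    Tendsto (fun p : Σ n, Ω n => v p.1 * (scaleMLE (Z p.1 p.2) / σ p.1 - sOne (ρ 0) α₀) -
      (limitMatrix (ρ 0) α₀ *ᵥ empProc (Z p.1 p.2) ρ α₀ (σ p.1) (v p.1)) 1)
      (probFilter P) (𝓝 0) := by
  have hr := hcond.welsch.map_zero_mem_Icc
  have hα := hcond.alpha_pos
  have hα₁ := alphaOne_pos hr hα
  have hdiv : alphaOne (ρ 0) α₀ / α₀ = varpi (ρ 0) := by
    rw [alphaOne, mul_div_cancel_right₀ _ hα.ne']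
  have hmem : alphaOne (ρ 0) α₀ ∈ Ioo αm αp := ⟨hcond.lower_lt, hcond.lt_upper⟩
  have ha := hcond.tendsto_shapeMLE hk hZpos hties
  set a : (Σ n, Ω n) → ℝ := fun p => (shapeMLE (Z p.1 p.2)).toReal with ha_def
  have hA := hcond.tendsto_dslope_powMean (fun n ω i => (hZpos n ω i).1) ha (j := 0) zero_le_one
  have hB := hcond.tendsto_dslope_powMean (fun n ω i => (hZpos n ω i).1) ha (j := 1) le_rfl
  have l0 := limitMean_rpow_mul_log_pow hcond.welsch hα hα₁.le 0
  have l1 := limitMean_rpow_mul_log_pow hcond.welsch hα hα₁.le 1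
  rw [hdiv] at l0 l1
  simp only [iteratedDeriv_succ, iteratedDeriv_zero, pow_zero, one_mul, mul_one, zero_add, pow_one]
    at hA hB l0 l1
  have hf : ∀ j, testFun (alphaOne (ρ 0) α₀) j ∈ classF2 αm αp := by
    intro j
    fin_cases j
    · exact Or.inl (Or.inr ⟨_, hmem, rfl⟩)
    · exact Or.inl (Or.inl (Or.inr ⟨_, hmem, rfl⟩))
    · exact Or.inl (Or.inl (Or.inl (Or.inr rfl)))
    · exact Or.inl (Or.inl (Or.inl (Or.inl rfl)))
  have he : ∀ j, Tendsto (fun p : Σ n, Ω n =>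
      empMean (Z p.1 p.2) (σ p.1) (testFun (alphaOne (ρ 0) α₀) j) -
        limitMean ρ α₀ (testFun (alphaOne (ρ 0) α₀) j)) (probFilter P) (𝓝 0) := by
    intro j
    have := tendsto_probFilter_of_tendstoInDistribution_const (hcond.lln _ (hf j))
    simpa using this.sub_const (limitMean ρ α₀ (testFun (alphaOne (ρ 0) α₀) j))
  have hp : ∀ p : Σ n, Ω n, powMean (Z p.1 p.2) (σ p.1) 1 (a p) =
      -1 / α₀ * deriv (Upsilon (ρ 0)) (varpi (ρ 0)) +
        (empMean (Z p.1 p.2) (σ p.1) (testFun (alphaOne (ρ 0) α₀) 0) -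
          limitMean ρ α₀ (testFun (alphaOne (ρ 0) α₀) 0)) -
        -dslope (powMean (Z p.1 p.2) (σ p.1) 1) (alphaOne (ρ 0) α₀) (a p) *
          (a p - alphaOne (ρ 0) α₀) := by
    intro p
    have e := sub_smul_dslope (powMean (Z p.1 p.2) (σ p.1) 1) (alphaOne (ρ 0) α₀) (a p)
    have e1 : empMean (Z p.1 p.2) (σ p.1) (testFun (alphaOne (ρ 0) α₀) 0) =
        powMean (Z p.1 p.2) (σ p.1) 1 (alphaOne (ρ 0) α₀) := by
      simp [testFun, powMean]
    have e2 : limitMean ρ α₀ (testFun (alphaOne (ρ 0) α₀) 0) =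
        -1 / α₀ * deriv (Upsilon (ρ 0)) (varpi (ρ 0)) := l1
    rw [smul_eq_mul] at e
    simp only [e1, e2]
    linear_combination -e
  have hq : ∀ p : Σ n, Ω n, powMean (Z p.1 p.2) (σ p.1) 0 (a p) =
      Upsilon (ρ 0) (varpi (ρ 0)) +
        (empMean (Z p.1 p.2) (σ p.1) (testFun (alphaOne (ρ 0) α₀) 1) -
          limitMean ρ α₀ (testFun (alphaOne (ρ 0) α₀) 1)) -
        -dslope (powMean (Z p.1 p.2) (σ p.1) 0) (alphaOne (ρ 0) α₀) (a p) *
          (a p - alphaOne (ρ 0) α₀) := by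
    intro p
    have e := sub_smul_dslope (powMean (Z p.1 p.2) (σ p.1) 0) (alphaOne (ρ 0) α₀) (a p)
    have e1 : empMean (Z p.1 p.2) (σ p.1) (testFun (alphaOne (ρ 0) α₀) 1) =
        powMean (Z p.1 p.2) (σ p.1) 0 (alphaOne (ρ 0) α₀) := by
      simp [testFun, powMean]
    have e2 : limitMean ρ α₀ (testFun (alphaOne (ρ 0) α₀) 1) =
        Upsilon (ρ 0) (varpi (ρ 0)) := l0
    rw [smul_eq_mul] at e
    simp only [e1, e2]
    linear_combination -e
  have h0 := limitMean_log_add hcond.welsch hα hα₁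
  rw [hdiv, PiFun_varpi hr, mul_zero] at h0
  have hs : ∀ᶠ p : Σ n, Ω n in probFilter P,
      2 / a p + 2 * (powMean (Z p.1 p.2) (σ p.1) 1 (a p) / powMean (Z p.1 p.2) (σ p.1) 0 (a p)) -
        (limitMean ρ α₀ (fun p => Real.log p.2) +
          (empMean (Z p.1 p.2) (σ p.1) (testFun (alphaOne (ρ 0) α₀) 2) -
            limitMean ρ α₀ (testFun (alphaOne (ρ 0) α₀) 2))) -
        (limitMean ρ α₀ (fun p => Real.log p.1) +
          (empMean (Z p.1 p.2) (σ p.1) (testFun (alphaOne (ρ 0) α₀) 3) -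
            limitMean ρ α₀ (testFun (alphaOne (ρ 0) α₀) 3))) = 0 := by
    filter_upwards [hties] with p hne
    have h := ((shapeMLE_scaleMLE_spec (hk _) (hZpos p.1 p.2) hne).2.2 _ (hcond.sigma_pos p.1)).1
    -- `testFun` at the indices `2` and `3` unfolds to the logarithms, so the limiting means cancel
    -- and the score equation is left.
    change _ - (limitMean ρ α₀ (fun p => Real.log p.2) +
      (empMean (Z p.1 p.2) (σ p.1) (fun p => Real.log p.2) -
        limitMean ρ α₀ (fun p => Real.log p.2))) - (limitMean ρ α₀ (fun p => Real.log p.1) +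
      (empMean (Z p.1 p.2) (σ p.1) (fun p => Real.log p.1) -
        limitMean ρ α₀ (fun p => Real.log p.1))) = 0
    rw [score] at h
    linear_combination h
  obtain ⟨c, d, hc, hd, hce, hde⟩ := exists_linearization (F := probFilter P) (a := a)
    (q := fun p => powMean (Z p.1 p.2) (σ p.1) 0 (a p))
    (p := fun p => powMean (Z p.1 p.2) (σ p.1) 1 (a p))
    (e := fun p j => empMean (Z p.1 p.2) (σ p.1) (testFun (alphaOne (ρ 0) α₀) j) -
      limitMean ρ α₀ (testFun (alphaOne (ρ 0) α₀) j))
    (c₃ := limitMean ρ α₀ fun p => Real.log p.2) (c₄ := limitMean ρ α₀ fun p => Real.log p.1)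
    hr hα ha hA hB he hp hq h0 hs
  refine ⟨hcond.tendsto_remainder hc hce, hcond.tendsto_remainder hd ?_⟩
  filter_upwards [hde, hties] with p hp hne
  rw [((shapeMLE_scaleMLE_spec (hk _) (hZpos p.1 p.2) hne).2.2 _ (hcond.sigma_pos p.1)).2]
  exact hp

end Asymptotics

/-! ### The main theorem. -/

theorem mainTheorem5
    {Ω : ℕ → Type*} [∀ n, MeasurableSpace (Ω n)]
    (P : ∀ n, Measure (Ω n)) [∀ n, IsProbabilityMeasure (P n)]
    {Ω' : Type*} [MeasurableSpace Ω'] (P' : Measure Ω') [IsProbabilityMeasure P']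
    (k : ℕ → ℕ) (hk2 : ∀ n, 2 ≤ k n) (hk : Tendsto k atTop atTop)
    (Z : ∀ n, Ω n → Fin (k n) → ℝ × ℝ) (hZ : ∀ n, Measurable (Z n))
    (hZpos : ∀ n ω i, 0 < (Z n ω i).2 ∧ (Z n ω i).2 ≤ (Z n ω i).1)
    (hties : Tendsto (fun n => P n {ω | AllEqual (Z n ω)}) atTop (𝓝 0))
    (ρ : ℝ → ℝ) (α₀ : ℝ) (σ : ℕ → ℝ) (αm αp : ℝ) (v : ℕ → ℝ) (W : Ω' → Fin 4 → ℝ)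
    (hcond : AsymptoticCondition P P' Z ρ α₀ σ αm αp v W) :
    (∀ ε : ℝ, 0 < ε →
      Tendsto (fun n => P n {ω | ENNReal.ofReal ε ≤
        EReal.abs ((v n : EReal) * (shapeMLE (Z n ω) - (alphaOne (ρ 0) α₀ : EReal)) -
          (((limitMatrix (ρ 0) α₀ *ᵥ empProc (Z n ω) ρ α₀ (σ n) (v n)) 0 : ℝ) : EReal))})
        atTop (𝓝 0)) ∧
    (∀ ε : ℝ, 0 < ε →
      Tendsto (fun n => P n {ω | ε ≤
        |v n * (scaleMLE (Z n ω) / σ n - sOne (ρ 0) α₀) -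
          (limitMatrix (ρ 0) α₀ *ᵥ empProc (Z n ω) ρ α₀ (σ n) (v n)) 1|})
        atTop (𝓝 0)) ∧
    TendstoInDistribution
      (fun n ω => ((v n : EReal) * (shapeMLE (Z n ω) - (alphaOne (ρ 0) α₀ : EReal)),
        v n * (scaleMLE (Z n ω) / σ n - sOne (ρ 0) α₀)))
      atTop
      (fun ω => ((((limitMatrix (ρ 0) α₀ *ᵥ W ω) 0 : ℝ) : EReal), (limitMatrix (ρ 0) α₀ *ᵥ W ω) 1))
      P P' ∧
    (ρ 0 = 1 →
      alphaOne (ρ 0) α₀ = α₀ ∧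
      limitMatrix (ρ 0) α₀ = (6 / (2 * Real.pi ^ 2 - 3)) •
        !![α₀ ^ 2, (3 - 2 * Real.eulerMascheroniConstant) / 2 * α₀, -α₀ ^ 2, -α₀ ^ 2;
          (2 * Real.eulerMascheroniConstant - 3) / 2,
          (3 - 2 * Real.pi ^ 2 - 3 * (3 - 2 * Real.eulerMascheroniConstant) ^ 2) / (12 * α₀),
          (3 - 2 * Real.eulerMascheroniConstant) / 2,
          (3 - 2 * Real.eulerMascheroniConstant) / 2]) := by
  have hk0 : ∀ n, 0 < k n := fun n => lt_of_lt_of_le two_pos (hk2 n)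
  have hties' : ∀ᶠ p : Σ n, Ω n in probFilter P, ¬ AllEqual (Z p.1 p.2) := by
    rw [eventually_probFilter]
    simpa only [not_not] using hties
  obtain ⟨h1, h2⟩ := hcond.tendsto_estimation_error hk0 hZpos hties'
  -- Outside the event of total ties the estimator is finite, so the extended-real error is the
  -- coercion of the real one.
  have hcoe : ∀ᶠ p : Σ n, Ω n in probFilter P,
      (v p.1 : EReal) * (shapeMLE (Z p.1 p.2) - (alphaOne (ρ 0) α₀ : EReal)) =
        ((v p.1 * ((shapeMLE (Z p.1 p.2)).toReal - alphaOne (ρ 0) α₀) : ℝ) : EReal) := by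
    filter_upwards [hties'] with p hne
    have h := (shapeMLE_scaleMLE_spec (hk0 _) (hZpos p.1 p.2) hne).2.1
    rw [EReal.coe_mul, EReal.coe_sub, ← h]
  refine ⟨fun ε hε => ?_, fun ε hε => ?_, ?_, fun h => ?_⟩
  · have : ∀ᶠ p : Σ n, Ω n in probFilter P, ¬ ENNReal.ofReal ε ≤
        EReal.abs ((v p.1 : EReal) * (shapeMLE (Z p.1 p.2) - (alphaOne (ρ 0) α₀ : EReal)) -
          (((limitMatrix (ρ 0) α₀ *ᵥ empProc (Z p.1 p.2) ρ α₀ (σ p.1) (v p.1)) 0 : ℝ) : EReal)) := by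
      filter_upwards [hcoe, Metric.tendsto_nhds.1 h1 ε hε] with p hp hlt
      rw [hp, ← EReal.coe_sub, EReal.abs_def, not_le, ENNReal.ofReal_lt_ofReal_iff hε]
      rwa [Real.dist_0_eq_abs] at hlt
    simpa only [not_not] using eventually_probFilter.1 this
  · have : ∀ᶠ p : Σ n, Ω n in probFilter P, ¬ ε ≤
        |v p.1 * (scaleMLE (Z p.1 p.2) / σ p.1 - sOne (ρ 0) α₀) -
          (limitMatrix (ρ 0) α₀ *ᵥ empProc (Z p.1 p.2) ρ α₀ (σ p.1) (v p.1)) 1| := by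
      filter_upwards [Metric.tendsto_nhds.1 h2 ε hε] with p hlt
      rw [Real.dist_0_eq_abs] at hlt
      exact hlt.not_ge
    simpa only [not_not] using eventually_probFilter.1 this
  · have hlin : Continuous fun w : Fin 4 → ℝ =>
        ((limitMatrix (ρ 0) α₀ *ᵥ w) 0, (limitMatrix (ρ 0) α₀ *ᵥ w) 1) := by
      have : Continuous fun w : Fin 4 → ℝ => limitMatrix (ρ 0) α₀ *ᵥ w :=
        continuous_const.matrix_mulVec continuous_id
      exact ((continuous_apply 0).comp this).prodMk ((continuous_apply 1).comp this)
    have hshape := fun n => measurable_shapeMLE (hk0 n) (hZ n) (hZpos n)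
    have hshapeR := fun n => measurable_shapeMLE_toReal (hk0 n) (hZ n) (hZpos n)
    have hscale := fun n => measurable_scaleMLE (hk0 n) (hZ n) (hZpos n)
    have hT := hcond.weak_limit.continuous_comp hlin
    -- Slutsky's lemma needs a normed space, so the limit is first taken in `ℝ × ℝ` with `toReal`,
    -- then mapped into `EReal × ℝ` and corrected on the event of total ties, whose probability
    -- tends to zero.
    have hreal := tendstoInDistribution_of_tendsto_sub hT
      (Y := fun n ω => (v n * ((shapeMLE (Z n ω)).toReal - alphaOne (ρ 0) α₀),
        v n * (scaleMLE (Z n ω) / σ n - sOne (ρ 0) α₀)))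
      (fun n => ((((hshapeR n).sub_const _).const_mul _).prodMk
        ((((hscale n).div_const _).sub_const _).const_mul _)).aemeasurable)
      (h1.prodMk_nhds h2)
    have hcont : Continuous fun x : ℝ × ℝ => ((x.1 : EReal), x.2) :=
      (continuous_coe_real_ereal.comp continuous_fst).prodMk continuous_snd
    refine tendstoInDistribution_congr_probFilter (hreal.continuous_comp hcont) (fun n => ?_) ?_
    · have hsub : Measurable fun ω => shapeMLE (Z n ω) - (alphaOne (ρ 0) α₀ : EReal) := by
        fun_prop
      exact ((measurable_const.mul hsub).prodMk
        ((((hscale n).div_const _).sub_const _).const_mul _)).aemeasurable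
    · filter_upwards [hcoe] with p hp
      exact Prod.ext hp.symm rfl
  · rw [h]
    exact ⟨alphaOne_one α₀, limitMatrix_one hcond.alpha_pos⟩
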